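/- Let $T>0$, let $m\ge 1$ be an integer and let $\alpha_0>\alpha_1>\dots>\alpha_m\ge 0$ be real numbers. Let $n_i$ be the nonnegative integer with $n_i-1<\alpha_i\le n_i$, and assume $n_0>n_1$. Let $a_1,\dots,a_m\in C[0,T]$ be real-valued. Put $H_j=\{i\in\{1,\dots,m\}: 0\le\alpha_i\le j\}$, assume $H_0\ne\emptyset$ (that is, $\alpha_m=0$), and put $h_j=\min H_j$. For $\alpha>0$ let $I_{0+}^{\alpha}f(t)=\frac1{\Gamma(\alpha)}\int_0^t(t-\tau)^{\alpha-1}f(\tau)\,d\tau$, and let $I_{0+}^0f=f$. For $\alpha\ge0$ and the nonnegative integer $n$ with $n-1<\alpha\le n$ let $$D_{0+}^{\alpha}f=\frac{d^n}{dt^n}I_{0+}^{n-\alpha}f,\qquad {}^cD_{0+}^{\alpha}f(t)=D_{0+}^{\alpha}\Big[f(t)-\sum_{k=0}^{n-1}\frac{f^{(k)}(0)}{k!}t^k\Big].$$ Let $C^{\alpha_0,n_0-1}[0,T]$ be the space of all real functions $y\in C^{n_0-1}[0,T]$ for which ${}^cD_{0+}^{\alpha_0}y$ exists on $(0,T)$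 and extends to a continuous function on $[0,T]$. Let $\Phi_{j+1}(t)=t^j/j!$ and $\Phi_{j+1-\alpha_i}=D_{0+}^{\alpha_i}\Phi_{j+1}$. Consider the equation $${}^cD_{0+}^{\alpha_0}y(t)=-\sum_{i=1}^m a_i(t)\,{}^cD_{0+}^{\alpha_i}y(t),\qquad 0<t<T, \tag{1}$$ and, for real $b_0,\dots,b_{n_0-1}$, the initial conditions $$D^ky(t)\big|_{t=+0}=b_k,\qquad k=0,1,\dots,n_0-1. \tag{2}$$ Then there are functions $y_0,\dots,y_{n_0-1}\in C^{\alpha_0,n_0-1}[0,T]$, not depending on the $b_k$, that form a canonical fundamental system of (1), i.e. each $y_j$ solves (1) and $D^ky_j(t)|_{t=+0}=\delta_{jk}$ for $k=0,\dots,n_0-1$, and that are given for $t\in[0,T]$ by the convergent series $$y_j(t)=\Phi_{j+1}(t)+\sum_{k=0}^{\infty}(-1)^{k+1}I_{0+}^{\alpha_0}\Big[\sum_{i=1}^m a_i(t)I_{0+}^{\alpha_0-\alpha_i}\Big]^k\sum_{i=h_j}^m a_i(t)\Phi_{j+1-\alpha_i}(t),\quad j=0,\dots,n_1-1,$$ $$y_j(t)=\Phi_{j+1}(t)+\sum_{k=0}^{\infty}(-1)^{k+1}I_{0+}^{\alpha_0}\Big[\sum_{i=1}^m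 a_i(t)I_{0+}^{\alpha_0-\alpha_i}\Big]^k\sum_{i=1}^m a_i(t)\Phi_{j+1-\alpha_i}(t),\quad j=n_1,\dots,n_0-1.$$ Moreover, for all real $b_0,\dots,b_{n_0-1}$, the initial value problem (1)-(2) has exactly one solution in $C^{\alpha_0,n_0-1}[0,T]$, namely $y(t)=\sum_{j=0}^{n_0-1}b_jy_j(t)$. -/

import Mathlib

open Set Filter Topology

namespace FracODE

noncomputable section

/-- Riemann–Liouville fractional integral `I_{0+}^α f`, with `I^0 f = f`. -/
def rlIntegral (α : ℝ) (f : ℝ → ℝ) (t : ℝ) : ℝ :=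
  if α = 0 then f t
  else (1 / Real.Gamma α) * ∫ τ in (0 : ℝ)..t, (t - τ) ^ (α - 1) * f τ

/-- Riemann–Liouville fractional derivative `D_{0+}^α f = (d/dt)^n I_{0+}^{n-α} f`, where `n` is the
nonnegative integer with `n - 1 < α ≤ n`. It is meant for `t > 0`. -/
def rlDeriv (α : ℝ) (f : ℝ → ℝ) (t : ℝ) : ℝ :=
  iteratedDeriv ⌈α⌉₊ (rlIntegral ((⌈α⌉₊ : ℝ) - α) f) t

/-- All the classical derivatives that occur in `D_{0+}^α f` exist on `(0, T)`. -/
def RLDifferentiableOn (T α : ℝ) (f : ℝ → ℝ) : Prop :=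
  ∀ k < ⌈α⌉₊, ∀ t ∈ Ioo 0 T,
    DifferentiableAt ℝ (iteratedDeriv k (rlIntegral ((⌈α⌉₊ : ℝ) - α) f)) t

/-- `f(t) - ∑_{k<n} f^{(k)}(0) t^k / k!` for a function `f` on `[0, T]` (one-sided derivatives
at the endpoint `0`). -/
def taylorRemainder (T : ℝ) (n : ℕ) (f : ℝ → ℝ) (t : ℝ) : ℝ :=
  f t - ∑ k ∈ Finset.range n,
    iteratedDerivWithin k f (Icc 0 T) 0 / (Nat.factorial k : ℝ) * t ^ k

/-- Caputo fractional derivative of order `α` of a function on `[0, T]`, for `0 < t < T`. -/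
def caputo (T α : ℝ) (f : ℝ → ℝ) (t : ℝ) : ℝ :=
  rlDeriv α (taylorRemainder T ⌈α⌉₊ f) t

/-- The Caputo derivative of order `α` exists on `(0, T)`. -/
def CaputoDifferentiableOn (T α : ℝ) (f : ℝ → ℝ) : Prop :=
  RLDifferentiableOn T α (taylorRemainder T ⌈α⌉₊ f)

/-- The space `C^{α,r}[0,T]`: functions in `C^r[0,T]` whose Caputo derivative of order `α` exists on
`(0, T)` and belongs to `C[0,T]`, that is, extends to a continuous function on `[0, T]`. -/
def MemCalpha (T α : ℝ) (r : ℕ) (f : ℝ → ℝ) : Prop :=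
  ContDiffOn ℝ r f (Icc 0 T) ∧ CaputoDifferentiableOn T α f ∧
    ∃ g : ℝ → ℝ, ContinuousOn g (Icc 0 T) ∧ EqOn (caputo T α f) g (Ioo 0 T)

/-- `y` satisfies the equation
`ᶜD^{α₀} y(t) = -∑_{i=1}^m a_i(t) ᶜD^{α_i} y(t)` for `0 < t < T`. -/
def SolvesEquation (T : ℝ) (m : ℕ) (α : ℕ → ℝ) (a : ℕ → ℝ → ℝ) (y : ℝ → ℝ) : Prop :=
  (∀ i ≤ m, CaputoDifferentiableOn T (α i) y) ∧
    ∀ t ∈ Ioo 0 T, caputo T (α 0) y t = -∑ i ∈ Finset.Icc 1 m, a i t * caputo T (α i) y t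

/-- The initial conditions `D^k y(t)|_{t=+0} = b_k` for `k < n`. -/
def HasInitialValues (T : ℝ) (n : ℕ) (b : ℕ → ℝ) (y : ℝ → ℝ) : Prop :=
  ∀ k < n, Tendsto (iteratedDerivWithin k y (Icc 0 T)) (𝓝[>] 0) (𝓝 (b k))

/-- `y` is a solution in `C^{α₀,n₀-1}[0,T]` of the equation with initial values `b_0, …, b_{n₀-1}`,
where `n₀ - 1 < α₀ ≤ n₀`. -/
def IsIVPSolution (T : ℝ) (m : ℕ) (α : ℕ → ℝ) (a : ℕ → ℝ → ℝ) (b : ℕ → ℝ) (y : ℝ → ℝ) : Prop :=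
  MemCalpha T (α 0) (⌈α 0⌉₊ - 1) y ∧ SolvesEquation T m α a y ∧
    HasInitialValues T ⌈α 0⌉₊ b y

/-- `y_0, …, y_{n₀-1}` is a canonical fundamental system in `C^{α₀,n₀-1}[0,T]`: `y_j` solves
the equation with initial values `D^k y_j(+0) = δ_{jk}`. -/
def IsCanonicalSystem (T : ℝ) (m : ℕ) (α : ℕ → ℝ) (a : ℕ → ℝ → ℝ) (y : ℕ → ℝ → ℝ) : Prop :=
  ∀ j < ⌈α 0⌉₊, IsIVPSolution T m α a (fun k => if j = k then 1 else 0) (y j)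

/-- The index set `H_j = {i : 0 ≤ α_i ≤ j, i = 1, …, m}`. -/
def idxH (m : ℕ) (α : ℕ → ℝ) (j : ℕ) : Set ℕ :=
  {i | 1 ≤ i ∧ i ≤ m ∧ 0 ≤ α i ∧ α i ≤ j}

/-- `h_j = min H_j` (for `H_j ≠ ∅`). -/
def idxh (m : ℕ) (α : ℕ → ℝ) (j : ℕ) : ℕ := sInf (idxH m α j)

/-- `Φ_{j+1}(t) = t^j / j!`. -/
def Phi (j : ℕ) (t : ℝ) : ℝ := t ^ j / (Nat.factorial j : ℝ)

/-- `Φ_{j+1-β} := D_{0+}^β Φ_{j+1}`. -/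
def PhiFrac (j : ℕ) (β : ℝ) : ℝ → ℝ := rlDeriv β (Phi j)

/-- The operator `∑_{i=1}^m a_i(t) I_{0+}^{α₀-α_i}`. -/
def opL (m : ℕ) (α : ℕ → ℝ) (a : ℕ → ℝ → ℝ) (f : ℝ → ℝ) (t : ℝ) : ℝ :=
  ∑ i ∈ Finset.Icc 1 m, a i t * rlIntegral (α 0 - α i) f t

/-- `∑_{i=p}^m a_i(t) Φ_{j+1-α_i}(t)`. -/
def sourceTerm (m : ℕ) (α : ℕ → ℝ) (a : ℕ → ℝ → ℝ) (p j : ℕ) (t : ℝ) : ℝ :=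
  ∑ i ∈ Finset.Icc p m, a i t * PhiFrac j (α i) t

/-- The `k`-th term
`(-1)^{k+1} I^{α₀} [∑_{i=1}^m a_i I^{α₀-α_i}]^k ∑_{i=p}^m a_i Φ_{j+1-α_i}` of the series. -/
def seriesTerm (m : ℕ) (α : ℕ → ℝ) (a : ℕ → ℝ → ℝ) (p j k : ℕ) (t : ℝ) : ℝ :=
  (-1) ^ (k + 1) * rlIntegral (α 0) ((opL m α a)^[k] (sourceTerm m α a p j)) t

end

end FracODE

namespace FracODE

open MeasureTheory

/-! The initial value problem is equivalent to a Volterra equation for `g = ᶜD^{α₀} y`. A function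
in the space with initial values `b_k` equals `∑ b_j Φ_{j+1} + I^{α₀} g`
(`eqOn_fracTaylor_of_caputo`). Conversely, for continuous `g` every function of this form lies in
the space, and its Caputo derivative of order `β ≤ α₀` is the sum of the `b_j I^{j-β} 1` with `j ≥
⌈β⌉`, plus `I^{α₀-β} g` (`caputo_of_eqOn_fracTaylor`). Substitution turns the equation into `g =
-S_b - L g`, where `L = ∑ a_i I^{α₀-α_i}` and `S_b` is linear in `b`.

All orders `α₀ - α_i` are positive, and `I^γ` has norm at most `λ^{-γ}` for the weight `e^{-λ t}`
(`abs_rlIntegral_le`). For large `λ` the operator `L` therefore halves the weighted norm. Hence the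
homogeneous equation has only the zero solution (`eq_zero_of_eq_neg_opL`), which gives uniqueness,
and the Neumann series solves the inhomogeneous one and may be integrated termwise
(`exists_neumann_series`). Applying `I^{α₀}` to that series for `b = δ_j` yields the stated
formulas. The term `Φ_{j+1}` contributes to `ᶜD^{α_i}` exactly when `α_i ≤ j`; since the `α_i`
decrease, this means `i ≥ h_j`, and it covers every `i` once `j ≥ n₁`. -/

/-! ### Linearity and weighted bounds for the fractional integral. -/

theorem rlIntegral_zero_order (f : ℝ → ℝ) : rlIntegral 0 f = f := by
  funext t; simp [rlIntegral]

theorem rlIntegral_of_ne {γ : ℝ} (hγ : γ ≠ 0) (f : ℝ → ℝ) (t : ℝ) :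
    rlIntegral γ f t = (1 / Real.Gamma γ) * ∫ τ in (0 : ℝ)..t, (t - τ) ^ (γ - 1) * f τ := by
  simp [rlIntegral, hγ]

theorem rlIntegral_at_zero {γ : ℝ} (hγ : γ ≠ 0) (f : ℝ → ℝ) : rlIntegral γ f 0 = 0 := by
  simp [rlIntegral_of_ne hγ]

theorem rlIntegral_one (f : ℝ → ℝ) (t : ℝ) : rlIntegral 1 f t = ∫ τ in (0 : ℝ)..t, f τ := by
  simp [rlIntegral_of_ne one_ne_zero]

theorem rlIntegral_congr_of_ne {γ t : ℝ} (hγ : γ ≠ 0) (ht : 0 ≤ t) {f g : ℝ → ℝ}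
    (h : EqOn f g (Ioo 0 t)) : rlIntegral γ f t = rlIntegral γ g t := by
  rw [rlIntegral_of_ne hγ, rlIntegral_of_ne hγ]
  congr 1
  rw [intervalIntegral.integral_of_le ht, intervalIntegral.integral_of_le ht,
    integral_Ioc_eq_integral_Ioo, integral_Ioc_eq_integral_Ioo]
  exact setIntegral_congr_fun measurableSet_Ioo fun s hs => by simp only [h hs]

theorem rlIntegral_congr {γ T : ℝ} {f g : ℝ → ℝ} (h : EqOn f g (Icc 0 T)) :
    EqOn (rlIntegral γ f) (rlIntegral γ g) (Icc 0 T) := by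
  intro t ht
  rcases eq_or_ne γ 0 with rfl | hγ
  · simpa only [rlIntegral_zero_order] using h ht
  · exact rlIntegral_congr_of_ne hγ ht.1 fun s hs => h ⟨hs.1.le, hs.2.le.trans ht.2⟩

theorem intervalIntegrable_kernel {γ : ℝ} (hγ : 0 < γ) (t : ℝ) :
    IntervalIntegrable (fun τ : ℝ => (t - τ) ^ (γ - 1)) volume 0 t := by
  have h := (intervalIntegral.intervalIntegrable_rpow' (a := 0) (b := t)
    (show -1 < γ - 1 by linarith)).comp_sub_left t
  simpa using h.symm

theorem intervalIntegrable_kernel_mul {γ T t : ℝ} (hγ : 0 < γ) {f : ℝ → ℝ}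
    (hf : ContinuousOn f (Icc 0 T)) (ht : t ∈ Icc 0 T) :
    IntervalIntegrable (fun τ : ℝ => (t - τ) ^ (γ - 1) * f τ) volume 0 t := by
  refine (intervalIntegrable_kernel hγ t).mul_continuousOn (hf.mono ?_)
  rw [uIcc_of_le ht.1]
  exact Icc_subset_Icc le_rfl ht.2

theorem rlIntegral_add {γ T t : ℝ} (hγ : 0 ≤ γ) {f g : ℝ → ℝ}
    (hf : ContinuousOn f (Icc 0 T)) (hg : ContinuousOn g (Icc 0 T)) (ht : t ∈ Icc 0 T) :
    rlIntegral γ (fun s => f s + g s) t = rlIntegral γ f t + rlIntegral γ g t := by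
  rcases hγ.eq_or_lt with rfl | hγ
  · simp only [rlIntegral_zero_order]
  · simp only [rlIntegral_of_ne hγ.ne', mul_add]
    rw [intervalIntegral.integral_add (intervalIntegrable_kernel_mul hγ hf ht)
      (intervalIntegrable_kernel_mul hγ hg ht), mul_add]

theorem rlIntegral_const_mul (γ c : ℝ) (f : ℝ → ℝ) (t : ℝ) :
    rlIntegral γ (fun s => c * f s) t = c * rlIntegral γ f t := by
  rcases eq_or_ne γ 0 with rfl | hγ
  · simp only [rlIntegral_zero_order]
  · simp only [rlIntegral_of_ne hγ, mul_left_comm _ c]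
    rw [intervalIntegral.integral_const_mul, mul_left_comm]

theorem rlIntegral_zero_fun (γ t : ℝ) : rlIntegral γ (fun _ => 0) t = 0 := by
  simpa using rlIntegral_const_mul γ 0 (fun _ => 0) t

theorem rlIntegral_neg (γ : ℝ) (f : ℝ → ℝ) (t : ℝ) :
    rlIntegral γ (fun s => -f s) t = -rlIntegral γ f t := by
  simpa using rlIntegral_const_mul γ (-1) f t

theorem rlIntegral_sub {γ T t : ℝ} (hγ : 0 ≤ γ) {f g : ℝ → ℝ}
    (hf : ContinuousOn f (Icc 0 T)) (hg : ContinuousOn g (Icc 0 T)) (ht : t ∈ Icc 0 T) :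
    rlIntegral γ (fun s => f s - g s) t = rlIntegral γ f t - rlIntegral γ g t := by
  simp only [sub_eq_add_neg]
  rw [rlIntegral_add (g := fun s => -g s) hγ hf hg.neg ht, rlIntegral_neg]

theorem rlIntegral_sum {ι : Type*} {γ T t : ℝ} (hγ : 0 ≤ γ) (s : Finset ι) {f : ι → ℝ → ℝ}
    (hf : ∀ i ∈ s, ContinuousOn (f i) (Icc 0 T)) (ht : t ∈ Icc 0 T) :
    rlIntegral γ (fun x => ∑ i ∈ s, f i x) t = ∑ i ∈ s, rlIntegral γ (f i) t := by
  classical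
  induction s using Finset.induction_on with
  | empty => simpa using rlIntegral_zero_fun γ t
  | insert i s his ih =>
    have hfs : ∀ j ∈ s, ContinuousOn (f j) (Icc 0 T) := fun j hj =>
      hf j (Finset.mem_insert_of_mem hj)
    simp only [Finset.sum_insert his]
    rw [rlIntegral_add hγ (hf i (Finset.mem_insert_self i s)) (continuousOn_finsetSum s hfs) ht,
      ih hfs]

/-- Exponential weights: `I^γ` is bounded by `λ^{-γ}` in the norm `sup |f(s)| e^{-λ s}`. -/
theorem abs_rlIntegral_le {γ l M t : ℝ} (hγ : 0 ≤ γ) (hl : 0 < l) (hM : 0 ≤ M) (ht : 0 ≤ t)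
    {f : ℝ → ℝ} (hf : ∀ s ∈ Icc 0 t, |f s| ≤ M * Real.exp (l * s)) :
    |rlIntegral γ f t| ≤ M * l ^ (-γ) * Real.exp (l * t) := by
  rcases hγ.eq_or_lt with rfl | hγ
  · simpa [rlIntegral_zero_order] using hf t ⟨ht, le_rfl⟩
  have hΓ := Real.Gamma_pos_of_pos hγ
  have hint : IntervalIntegrable (fun τ : ℝ => (t - τ) ^ (γ - 1) * (M * Real.exp (l * τ)))
      volume 0 t :=
    intervalIntegrable_kernel_mul (T := t) hγ (by fun_prop) ⟨ht, le_rfl⟩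
  have h1 : |∫ τ in (0 : ℝ)..t, (t - τ) ^ (γ - 1) * f τ| ≤
      ∫ τ in (0 : ℝ)..t, (t - τ) ^ (γ - 1) * (M * Real.exp (l * τ)) := by
    rw [← Real.norm_eq_abs]
    refine intervalIntegral.norm_integral_le_of_norm_le ht ?_ hint
    filter_upwards with s hs
    have hk : 0 ≤ (t - s) ^ (γ - 1) := Real.rpow_nonneg (by linarith [hs.2]) _
    rw [Real.norm_eq_abs, abs_mul, abs_of_nonneg hk]
    exact mul_le_mul_of_nonneg_left (hf s ⟨hs.1.le, hs.2⟩) hk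
  have h2 : ∫ τ in (0 : ℝ)..t, (t - τ) ^ (γ - 1) * (M * Real.exp (l * τ)) =
      M * Real.exp (l * t) * ∫ u in (0 : ℝ)..t, u ^ (γ - 1) * Real.exp (-(l * u)) := by
    have := intervalIntegral.integral_comp_sub_left (a := 0) (b := t)
      (fun u => u ^ (γ - 1) * (M * Real.exp (l * (t - u)))) t
    simp only [sub_sub_cancel, sub_self, sub_zero] at this
    rw [this, ← intervalIntegral.integral_const_mul]
    refine intervalIntegral.integral_congr fun u _ => ?_
    rw [show l * (t - u) = l * t + -(l * u) by ring, Real.exp_add]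
    ring
  have h3 : ∫ u in (0 : ℝ)..t, u ^ (γ - 1) * Real.exp (-(l * u)) ≤ (1 / l) ^ γ * Real.Gamma γ := by
    rw [← Real.integral_rpow_mul_exp_neg_mul_Ioi hγ hl, intervalIntegral.integral_of_le ht]
    refine setIntegral_mono_set ?_ ?_ (Eventually.of_forall fun u hu => hu.1)
    -- Integrability of the Gamma integrand comes from its known value: a non-integrable function
    -- would have integral 0, but the value is positive.
    · by_contra hcon
      have h0 := Real.integral_rpow_mul_exp_neg_mul_Ioi hγ hl
      rw [integral_undef hcon] at h0
      have : 0 < (1 / l) ^ γ * Real.Gamma γ := by positivity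
      linarith
    · refine (ae_restrict_iff' measurableSet_Ioi).2 (Eventually.of_forall fun u hu => ?_)
      have hu' : (0 : ℝ) < u := hu
      simp only [Pi.zero_apply]
      positivity
  rw [rlIntegral_of_ne hγ.ne', abs_mul, abs_of_nonneg (by positivity)]
  calc 1 / Real.Gamma γ * |∫ τ in (0 : ℝ)..t, (t - τ) ^ (γ - 1) * f τ|
      ≤ 1 / Real.Gamma γ * (M * Real.exp (l * t) * ((1 / l) ^ γ * Real.Gamma γ)) := by
        refine mul_le_mul_of_nonneg_left (h1.trans ?_) (by positivity)
        rw [h2]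
        exact mul_le_mul_of_nonneg_left h3 (by positivity)
    _ = M * l ^ (-γ) * Real.exp (l * t) := by
        rw [Real.rpow_neg hl.le, one_div l, Real.inv_rpow hl.le]
        field_simp

/-- The weight `λ = 1` makes the factor `λ^{-γ}` equal to 1, so the bound is uniform in the order
`γ`. -/
theorem abs_rlIntegral_le_of_bound {γ ε t : ℝ} (hγ : 0 ≤ γ) (ht : 0 ≤ t) (hε : 0 ≤ ε)
    {f : ℝ → ℝ} (hf : ∀ s ∈ Icc 0 t, |f s| ≤ ε * Real.exp s) :
    |rlIntegral γ f t| ≤ ε * Real.exp t := by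
  simpa using abs_rlIntegral_le hγ one_pos hε ht (f := f) (by simpa using hf)

/-! ### Continuity, semigroup law and differentiation of fractional integrals. -/

/-- This is the Beta integral rescaled to `[0, t]`, transferred from its complex form. -/
theorem integral_kernel_mul_rpow {γ p t : ℝ} (hγ : 0 < γ) (hp : 0 ≤ p) (ht : 0 < t) :
    ∫ τ in (0 : ℝ)..t, (t - τ) ^ (γ - 1) * τ ^ p =
      t ^ (p + γ) * (Real.Gamma (p + 1) * Real.Gamma γ / Real.Gamma (p + γ + 1)) := by
  have h := Complex.betaIntegral_scaled ((p + 1 : ℝ) : ℂ) (γ : ℂ) ht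
  rw [Complex.betaIntegral_eq_Gamma_mul_div _ _ (by simp; linarith) (by simpa using hγ),
    ← Complex.ofReal_add, Complex.Gamma_ofReal, Complex.Gamma_ofReal, Complex.Gamma_ofReal] at h
  have hL : ∫ x in (0 : ℝ)..t, (x : ℂ) ^ (((p + 1 : ℝ) : ℂ) - 1) * ((t : ℂ) - x) ^ ((γ : ℂ) - 1) =
      ((∫ τ in (0 : ℝ)..t, (t - τ) ^ (γ - 1) * τ ^ p : ℝ) : ℂ) := by
    rw [← intervalIntegral.integral_ofReal]
    refine intervalIntegral.integral_congr fun x hx => ?_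
    rw [uIcc_of_le ht.le] at hx
    rw [Complex.ofReal_mul, Complex.ofReal_cpow hx.1, Complex.ofReal_cpow (by linarith [hx.2])]
    push_cast
    rw [mul_comm, add_sub_cancel_right]
  rw [hL] at h
  have hexp : ((p + 1 + γ : ℝ) : ℂ) - 1 = ((p + γ : ℝ) : ℂ) := by push_cast; ring
  rw [hexp, ← Complex.ofReal_cpow ht.le] at h
  rw [show p + γ + 1 = p + 1 + γ by ring]
  exact_mod_cast h

theorem rlIntegral_rpow {γ p t : ℝ} (hγ : 0 ≤ γ) (hp : 0 ≤ p) (ht : 0 ≤ t) :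
    rlIntegral γ (fun s => s ^ p) t =
      Real.Gamma (p + 1) / Real.Gamma (p + γ + 1) * t ^ (p + γ) := by
  have hΓp : 0 < Real.Gamma (p + 1) := Real.Gamma_pos_of_pos (by linarith)
  rcases hγ.eq_or_lt with rfl | hγ
  · simp [rlIntegral_zero_order, hΓp.ne']
  have hΓ := Real.Gamma_pos_of_pos hγ
  rcases ht.eq_or_lt with rfl | ht
  · rw [rlIntegral_at_zero hγ.ne', Real.zero_rpow (by linarith), mul_zero]
  rw [rlIntegral_of_ne hγ.ne', integral_kernel_mul_rpow hγ hp ht]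
  field_simp

theorem rlIntegral_rlIntegral_rpow {γ δ p t : ℝ} (hγ : 0 ≤ γ) (hδ : 0 ≤ δ) (hp : 0 ≤ p)
    (ht : 0 ≤ t) :
    rlIntegral γ (rlIntegral δ (fun s => s ^ p)) t = rlIntegral (γ + δ) (fun s => s ^ p) t := by
  have h : EqOn (rlIntegral δ (fun s => s ^ p))
      (fun s => Real.Gamma (p + 1) / Real.Gamma (p + δ + 1) * s ^ (p + δ)) (Icc 0 t) :=
    fun s hs => rlIntegral_rpow hδ hp hs.1
  rw [rlIntegral_congr h ⟨ht, le_rfl⟩, rlIntegral_const_mul,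
    rlIntegral_rpow hγ (by positivity) ht, rlIntegral_rpow (by positivity) hp ht]
  have hΓp : 0 < Real.Gamma (p + δ + 1) := Real.Gamma_pos_of_pos (by linarith)
  rw [show p + δ + γ = p + (γ + δ) by ring]
  field_simp

theorem continuousOn_rlIntegral_polynomial {γ : ℝ} (hγ : 0 ≤ γ) (T : ℝ) (p : Polynomial ℝ) :
    ContinuousOn (rlIntegral γ fun s => p.eval s) (Icc 0 T) := by
  induction p using Polynomial.induction_on' with
  | add p q hp hq =>
    refine (hp.add hq).congr fun t ht => ?_
    simp only [Polynomial.eval_add]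
    exact rlIntegral_add hγ p.continuous.continuousOn q.continuous.continuousOn ht
  | monomial n c =>
    have h : EqOn (rlIntegral γ fun s => (Polynomial.monomial n c).eval s)
        (fun t => c * (Real.Gamma ((n : ℝ) + 1) / Real.Gamma (n + γ + 1) * t ^ ((n : ℝ) + γ)))
        (Icc 0 T) := by
      intro t ht
      simp only [Polynomial.eval_monomial]
      rw [rlIntegral_const_mul, ← rlIntegral_rpow hγ n.cast_nonneg ht.1]
      simp only [Real.rpow_natCast]
    refine ContinuousOn.congr ?_ h
    have : Continuous fun t : ℝ => t ^ ((n : ℝ) + γ) :=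
      Real.continuous_rpow_const (by positivity)
    fun_prop

theorem rlIntegral_rlIntegral_polynomial {γ δ t : ℝ} (hγ : 0 ≤ γ) (hδ : 0 ≤ δ) (ht : 0 ≤ t)
    (p : Polynomial ℝ) :
    rlIntegral γ (rlIntegral δ fun s => p.eval s) t = rlIntegral (γ + δ) (fun s => p.eval s) t := by
  induction p using Polynomial.induction_on' with
  | add p q hp hq =>
    have ht' : t ∈ Icc 0 t := ⟨ht, le_rfl⟩
    have h : EqOn (rlIntegral δ fun s => (p + q).eval s)
        (fun s => rlIntegral δ (fun s => p.eval s) s + rlIntegral δ (fun s => q.eval s) s)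
        (Icc 0 t) := by
      intro s hs
      simp only [Polynomial.eval_add]
      exact rlIntegral_add hδ p.continuous.continuousOn q.continuous.continuousOn hs
    rw [rlIntegral_congr h ht', rlIntegral_add hγ (continuousOn_rlIntegral_polynomial hδ t p)
      (continuousOn_rlIntegral_polynomial hδ t q) ht', hp, hq]
    simp only [Polynomial.eval_add]
    exact (rlIntegral_add (by positivity) p.continuous.continuousOn q.continuous.continuousOn
      ht').symm
  | monomial n c =>
    have h : (rlIntegral δ fun s => (Polynomial.monomial n c).eval s) =
        fun s => c * rlIntegral δ (fun s => s ^ (n : ℝ)) s := by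
      funext s
      simp only [Polynomial.eval_monomial, ← Real.rpow_natCast, rlIntegral_const_mul]
    rw [h, rlIntegral_const_mul, rlIntegral_rlIntegral_rpow hγ hδ n.cast_nonneg ht]
    simp only [Polynomial.eval_monomial, ← Real.rpow_natCast, rlIntegral_const_mul]

/-- Weierstrass approximation and the order-free bound: one polynomial serves all `γ ≥ 0` at once.
Claims about `I^γ` on continuous functions thus reduce to monomials. -/
theorem exists_polynomial_rlIntegral_near {T ε : ℝ} {f : ℝ → ℝ}
    (hf : ContinuousOn f (Icc 0 T)) (hε : 0 < ε) :
    ∃ p : Polynomial ℝ, ∀ t ∈ Icc 0 T, ∀ γ, 0 ≤ γ →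
      |rlIntegral γ f t - rlIntegral γ (fun s => p.eval s) t| ≤ ε * Real.exp t := by
  obtain ⟨p, hp⟩ := exists_polynomial_near_of_continuousOn 0 T f hf ε hε
  refine ⟨p, fun t ht γ hγ => ?_⟩
  rw [← rlIntegral_sub hγ hf p.continuous.continuousOn ht]
  refine abs_rlIntegral_le_of_bound hγ ht.1 hε.le fun s hs => ?_
  rw [abs_sub_comm]
  refine (hp s ⟨hs.1, hs.2.trans ht.2⟩).le.trans ?_
  exact le_mul_of_one_le_right hε.le (Real.one_le_exp hs.1)

theorem continuousOn_rlIntegral {γ T : ℝ} (hγ : 0 ≤ γ) {f : ℝ → ℝ}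
    (hf : ContinuousOn f (Icc 0 T)) : ContinuousOn (rlIntegral γ f) (Icc 0 T) := by
  refine continuousOn_of_uniform_approx_of_continuousOn fun u hu => ?_
  obtain ⟨ε, hε, hεu⟩ := Metric.mem_uniformity_dist.1 hu
  obtain ⟨p, hp⟩ := exists_polynomial_rlIntegral_near hf
    (show 0 < ε / 2 * Real.exp (-T) by positivity)
  refine ⟨_, continuousOn_rlIntegral_polynomial hγ T p, fun t ht => hεu ?_⟩
  rw [Real.dist_eq]
  refine (hp t ht γ hγ).trans_lt ?_
  have : Real.exp (-T) * Real.exp t ≤ 1 := by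
    rw [← Real.exp_add, Real.exp_le_one_iff]
    linarith [ht.2]
  nlinarith

/-- Both sides are stable under uniform approximation of `f`, and the law holds for polynomials by
the Gamma quotients of the power rule; no interchange of integrals is needed. -/
theorem rlIntegral_rlIntegral {γ δ T t : ℝ} (hγ : 0 ≤ γ) (hδ : 0 ≤ δ) {f : ℝ → ℝ}
    (hf : ContinuousOn f (Icc 0 T)) (ht : t ∈ Icc 0 T) :
    rlIntegral γ (rlIntegral δ f) t = rlIntegral (γ + δ) f t := by
  refine eq_of_abs_sub_le_all fun ε hε => ?_
  obtain ⟨p, hp⟩ := exists_polynomial_rlIntegral_near hf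
    (show 0 < ε / 2 * Real.exp (-t) by positivity)
  have h1 : |rlIntegral γ (rlIntegral δ f) t -
      rlIntegral γ (rlIntegral δ fun s => p.eval s) t| ≤ ε / 2 * Real.exp (-t) * Real.exp t := by
    rw [← rlIntegral_sub hγ (continuousOn_rlIntegral hδ hf)
      (continuousOn_rlIntegral_polynomial hδ T p) ht]
    exact abs_rlIntegral_le_of_bound hγ ht.1 (by positivity) fun s hs =>
      hp s ⟨hs.1, hs.2.trans ht.2⟩ δ hδ
  have h2 := hp t ht (γ + δ) (by positivity)
  rw [rlIntegral_rlIntegral_polynomial hγ hδ ht.1] at h1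
  rw [mul_assoc, ← Real.exp_add, neg_add_cancel, Real.exp_zero, mul_one, abs_le] at h1 h2
  rw [abs_le]
  constructor <;> linarith [h1.1, h1.2, h2.1, h2.2]

/-- By the semigroup law `I^{γ+1} f` is the ordinary primitive of the continuous function `I^γ f`.
The derivative is one-sided at the endpoints. -/
theorem hasDerivWithinAt_rlIntegral {γ T t : ℝ} (hγ : 0 ≤ γ) {f : ℝ → ℝ}
    (hf : ContinuousOn f (Icc 0 T)) (ht : t ∈ Icc 0 T) :
    HasDerivWithinAt (rlIntegral (γ + 1) f) (rlIntegral γ f t) (Icc 0 T) t := by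
  have hc := continuousOn_rlIntegral hγ hf
  have h : ∀ s ∈ Icc 0 T, rlIntegral (γ + 1) f s = ∫ τ in (0 : ℝ)..s, rlIntegral γ f τ := by
    intro s hs
    rw [← rlIntegral_one, rlIntegral_rlIntegral zero_le_one hγ hf hs, add_comm]
  refine HasDerivWithinAt.congr ?_ h (h t ht)
  have : Fact (t ∈ Icc 0 T) := ⟨ht⟩
  refine intervalIntegral.integral_hasDerivWithinAt_right (t := Icc 0 T) ?_
    (hc.stronglyMeasurableAtFilter_nhdsWithin measurableSet_Icc t) (hc t ht)
  refine ContinuousOn.intervalIntegrable (hc.mono ?_)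
  rw [uIcc_of_le ht.1]
  exact Icc_subset_Icc le_rfl ht.2

/-- Dominated convergence: the geometric majorant times the integrable kernel is summable with
integrable sum. -/
theorem hasSum_rlIntegral {γ T t C : ℝ} {r : ℝ} (hγ : 0 ≤ γ) (hr : 0 ≤ r) (hr1 : r < 1)
    {f : ℕ → ℝ → ℝ} {g : ℝ → ℝ}
    (hf : ∀ k, ContinuousOn (f k) (Icc 0 T)) (hC : ∀ k, ∀ s ∈ Icc 0 T, |f k s| ≤ C * r ^ k)
    (hg : ∀ s ∈ Icc 0 T, HasSum (fun k => f k s) (g s)) (ht : t ∈ Icc 0 T) :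
    HasSum (fun k => rlIntegral γ (f k) t) (rlIntegral γ g t) := by
  rcases hγ.eq_or_lt with rfl | hγ
  · simpa only [rlIntegral_zero_order] using hg t ht
  simp only [rlIntegral_of_ne hγ.ne']
  refine HasSum.mul_left _ ?_
  have hsub : ∀ s, s ∈ uIoc 0 t → s ∈ Icc 0 T := by
    intro s hs
    rw [uIoc_of_le ht.1] at hs
    exact ⟨hs.1.le, hs.2.trans ht.2⟩
  have hgeo := (summable_geometric_of_lt_one hr hr1).mul_left C
  refine intervalIntegral.hasSum_integral_of_dominated_convergence
    (fun k s => (t - s) ^ (γ - 1) * (C * r ^ k)) (fun k => ?_) (fun k => ?_) ?_ ?_ ?_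
  · rw [uIoc_of_le ht.1]
    exact (intervalIntegrable_kernel_mul hγ (hf k) ht).1.aestronglyMeasurable
  · filter_upwards with s hs
    have hs' := hsub s hs
    rw [uIoc_of_le ht.1] at hs
    have hk : 0 ≤ (t - s) ^ (γ - 1) := Real.rpow_nonneg (by linarith [hs.2]) _
    rw [Real.norm_eq_abs, abs_mul, abs_of_nonneg hk]
    exact mul_le_mul_of_nonneg_left (hC k s hs') hk
  · filter_upwards with s hs using hgeo.mul_left _
  · simp only [tsum_mul_left]
    exact (intervalIntegrable_kernel hγ t).mul_const _
  · filter_upwards with s hs using (hg s (hsub s hs)).mul_left _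

/-! ### Iterated derivatives along an explicit chain `u_k' = u_{k+1}`. -/

theorem iteratedDeriv_eqOn_of_chain {s : Set ℝ} (hs : IsOpen s) {n : ℕ} {u : ℕ → ℝ → ℝ}
    {F : ℝ → ℝ} (h0 : EqOn F (u 0) s)
    (h : ∀ k < n, ∀ t ∈ s, HasDerivAt (u k) (u (k + 1) t) t) :
    ∀ k ≤ n, EqOn (iteratedDeriv k F) (u k) s := by
  intro k
  induction k with
  | zero => intro _ t ht; simpa using h0 ht
  | succ k ih =>
    intro hk t ht
    rw [iteratedDeriv_succ, ((ih (by omega)).eventuallyEq_of_mem (hs.mem_nhds ht)).deriv_eq]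
    exact (h k (by omega) t ht).deriv

theorem differentiableAt_iteratedDeriv_of_chain {s : Set ℝ} (hs : IsOpen s) {n : ℕ}
    {u : ℕ → ℝ → ℝ} {F : ℝ → ℝ} (h0 : EqOn F (u 0) s)
    (h : ∀ k < n, ∀ t ∈ s, HasDerivAt (u k) (u (k + 1) t) t) :
    ∀ k < n, ∀ t ∈ s, DifferentiableAt ℝ (iteratedDeriv k F) t := by
  intro k hk t ht
  exact (((iteratedDeriv_eqOn_of_chain hs h0 h k hk.le).eventuallyEq_of_mem
    (hs.mem_nhds ht)).differentiableAt_iff).2 (h k hk t ht).differentiableAt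

theorem iteratedDerivWithin_eqOn_of_chain {s : Set ℝ} (hs : UniqueDiffOn ℝ s) {n : ℕ}
    {u : ℕ → ℝ → ℝ} {F : ℝ → ℝ} (h0 : EqOn F (u 0) s)
    (h : ∀ k < n, ∀ t ∈ s, HasDerivWithinAt (u k) (u (k + 1) t) s t) :
    ∀ k ≤ n, EqOn (iteratedDerivWithin k F s) (u k) s := by
  intro k
  induction k with
  | zero => intro _ t ht; simpa using h0 ht
  | succ k ih =>
    intro hk t ht
    rw [iteratedDerivWithin_succ, derivWithin_congr (ih (by omega)) (ih (by omega) ht)]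
    exact (h k (by omega) t ht).derivWithin (hs t ht)

theorem contDiffOn_of_chain {s : Set ℝ} (hs : UniqueDiffOn ℝ s) {n : ℕ}
    {u : ℕ → ℝ → ℝ} {F : ℝ → ℝ} (h0 : EqOn F (u 0) s)
    (h : ∀ k < n, ∀ t ∈ s, HasDerivWithinAt (u k) (u (k + 1) t) s t)
    (hn : ContinuousOn (u n) s) : ContDiffOn ℝ n F s := by
  have he := iteratedDerivWithin_eqOn_of_chain hs h0 h
  refine (contDiffOn_nat_iff_continuousOn_differentiableOn_deriv hs).2
    ⟨fun k hk => ContinuousOn.congr ?_ (he k hk), fun k hk => DifferentiableOn.congr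
      (fun t ht => (h k hk t ht).differentiableWithinAt) (he k hk.le)⟩
  rcases hk.eq_or_lt with rfl | hk
  · exact hn
  · exact fun t ht => (h k hk t ht).continuousWithinAt

theorem eqOn_of_rlIntegral_one_eqOn {T : ℝ} (hT : 0 < T) {f g : ℝ → ℝ}
    (hf : ContinuousOn f (Icc 0 T)) (hg : ContinuousOn g (Icc 0 T))
    (h : EqOn (rlIntegral 1 f) (rlIntegral 1 g) (Icc 0 T)) : EqOn f g (Icc 0 T) := by
  intro t ht
  have h1 := hasDerivWithinAt_rlIntegral le_rfl hf ht
  have h2 := hasDerivWithinAt_rlIntegral le_rfl hg ht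
  rw [zero_add, rlIntegral_zero_order] at h1 h2
  exact (uniqueDiffOn_Icc hT t ht).eq_deriv _ h1 (h2.congr h (h ht))

/-- A function on `[0, T]` with vanishing initial values is the iterated integral of its
highest derivative. -/
theorem eqOn_rlIntegral_iteratedDerivWithin {T : ℝ} (hT : 0 < T) {n : ℕ} {f : ℝ → ℝ}
    (hf : ContDiffOn ℝ n f (Icc 0 T)) (h0 : ∀ k < n, iteratedDerivWithin k f (Icc 0 T) 0 = 0) :
    EqOn f (rlIntegral n (iteratedDerivWithin n f (Icc 0 T))) (Icc 0 T) := by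
  have hu := uniqueDiffOn_Icc hT
  induction n with
  | zero => intro t _; simp [rlIntegral_zero_order]
  | succ n ih =>
    have hc := hf.continuousOn_iteratedDerivWithin (m := n + 1) le_rfl hu
    have hc' := hf.continuousOn_iteratedDerivWithin (m := n) (by exact_mod_cast n.le_succ) hu
    have hd := hf.differentiableOn_iteratedDerivWithin (m := n) (by exact_mod_cast n.lt_succ_self) hu
    have key : EqOn (iteratedDerivWithin n f (Icc 0 T))
        (rlIntegral 1 (iteratedDerivWithin (n + 1) f (Icc 0 T))) (Icc 0 T) := by
      intro t ht
      rw [rlIntegral_one]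
      have hsub : Icc 0 t ⊆ Icc 0 T := Icc_subset_Icc le_rfl ht.2
      rw [intervalIntegral.integral_eq_sub_of_hasDerivAt_of_le ht.1 (hc'.mono hsub) (fun s hs => ?_)
        (ContinuousOn.intervalIntegrable (by rw [uIcc_of_le ht.1]; exact hc.mono hsub)),
        h0 n n.lt_succ_self, sub_zero]
      have hs' : s ∈ Icc 0 T := hsub ⟨hs.1.le, hs.2.le⟩
      rw [iteratedDerivWithin_succ]
      exact (hd s hs').hasDerivWithinAt.hasDerivAt (Icc_mem_nhds hs.1 (hs.2.trans_le ht.2))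
    intro t ht
    rw [ih (hf.of_le (by exact_mod_cast n.le_succ)) (fun k hk => h0 k (by omega)) ht,
      rlIntegral_congr key ht, rlIntegral_rlIntegral n.cast_nonneg zero_le_one hc ht]
    push_cast
    rfl

/-! ### Calculus of functions `∑ c_j I^{j-β} 1 + I^{α₀-β} g`. -/

theorem rlIntegral_const_one {γ t : ℝ} (hγ : 0 ≤ γ) (ht : 0 ≤ t) :
    rlIntegral γ (fun _ => 1) t = t ^ γ / Real.Gamma (γ + 1) := by
  have := rlIntegral_rpow hγ le_rfl ht
  simp only [Real.rpow_zero, zero_add, Real.Gamma_one] at this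
  rw [this]
  ring

theorem rlIntegral_const_one_nat (j : ℕ) {t : ℝ} (ht : 0 ≤ t) :
    rlIntegral j (fun _ => 1) t = Phi j t := by
  rw [rlIntegral_const_one j.cast_nonneg ht, Real.Gamma_nat_eq_factorial, Real.rpow_natCast, Phi]

/-- `∑_{p ≤ j < n₀} c_j I^{j-β} 1 + I^{α₀-β} g`, where `n₀ = ⌈α₀⌉`. -/
noncomputable def fracTaylor (α₀ : ℝ) (c : ℕ → ℝ) (g : ℝ → ℝ) (p : ℕ) (β t : ℝ) : ℝ :=
  ∑ j ∈ Finset.Ico p ⌈α₀⌉₊, c j * rlIntegral (j - β) (fun _ => 1) t + rlIntegral (α₀ - β) g t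

section FracTaylor

variable {T α₀ : ℝ} {c : ℕ → ℝ} {g : ℝ → ℝ}

theorem continuousOn_fracTaylor (hg : ContinuousOn g (Icc 0 T)) {p : ℕ} {β : ℝ}
    (hp : β ≤ p) (hβ : β ≤ α₀) : ContinuousOn (fracTaylor α₀ c g p β) (Icc 0 T) := by
  refine ContinuousOn.add (continuousOn_finsetSum _ fun j hj => ?_)
    (continuousOn_rlIntegral (by linarith) hg)
  have : (p : ℝ) ≤ j := by exact_mod_cast (Finset.mem_Ico.1 hj).1
  exact continuousOn_const.mul (continuousOn_rlIntegral (by linarith) continuousOn_const)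

theorem hasDerivWithinAt_fracTaylor (hg : ContinuousOn g (Icc 0 T)) {p : ℕ} {β : ℝ}
    (hp : β + 1 ≤ p) (hβ : β + 1 ≤ α₀) {t : ℝ} (ht : t ∈ Icc 0 T) :
    HasDerivWithinAt (fracTaylor α₀ c g p β) (fracTaylor α₀ c g p (β + 1) t) (Icc 0 T) t := by
  refine HasDerivWithinAt.add (HasDerivWithinAt.fun_sum fun j hj => ?_) ?_
  · have : (p : ℝ) ≤ j := by exact_mod_cast (Finset.mem_Ico.1 hj).1
    have h := hasDerivWithinAt_rlIntegral (γ := j - (β + 1)) (T := T) (f := fun _ => 1)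
      (by linarith) continuousOn_const ht
    rw [show (j : ℝ) - (β + 1) + 1 = j - β by ring] at h
    exact h.const_mul (c j)
  · have h := hasDerivWithinAt_rlIntegral (γ := α₀ - (β + 1)) (by linarith) hg ht
    rwa [show α₀ - (β + 1) + 1 = α₀ - β by ring] at h

/-- At integer order `β = k` the lowest summand is the constant `c k`, which differentiation kills;
so the cutoff `p` rises together with the order. -/
theorem hasDerivWithinAt_fracTaylor_nat (hg : ContinuousOn g (Icc 0 T)) {k : ℕ}
    (hk : k + 1 < ⌈α₀⌉₊) {t : ℝ} (ht : t ∈ Icc 0 T) :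
    HasDerivWithinAt (fracTaylor α₀ c g k k) (fracTaylor α₀ c g (k + 1) ((k + 1 : ℕ) : ℝ) t)
      (Icc 0 T) t := by
  have hα : ((k + 1 : ℕ) : ℝ) < α₀ := Nat.lt_ceil.1 hk
  have h : fracTaylor α₀ c g k k = fun s => c k + fracTaylor α₀ c g (k + 1) k s := by
    funext s
    simp only [fracTaylor]
    rw [Finset.sum_eq_sum_Ico_succ_bot (by omega), sub_self, rlIntegral_zero_order]
    ring
  push_cast at hα
  rw [h, Nat.cast_add_one]
  exact (hasDerivWithinAt_fracTaylor hg (by push_cast; rfl) hα.le ht).const_add (c k)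

theorem rlIntegral_fracTaylor (hg : ContinuousOn g (Icc 0 T)) {p : ℕ} {β δ : ℝ}
    (hp : β ≤ p) (hβ : β ≤ α₀) (hδ : 0 ≤ δ) {t : ℝ} (ht : t ∈ Icc 0 T) :
    rlIntegral δ (fracTaylor α₀ c g p β) t = fracTaylor α₀ c g p (β - δ) t := by
  have hj : ∀ j ∈ Finset.Ico p ⌈α₀⌉₊, 0 ≤ (j : ℝ) - β := fun j hj => by
    have : (p : ℝ) ≤ j := by exact_mod_cast (Finset.mem_Ico.1 hj).1
    linarith
  have hcj : ∀ j ∈ Finset.Ico p ⌈α₀⌉₊, ContinuousOn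
      (fun t => c j * rlIntegral (j - β) (fun _ => 1) t) (Icc 0 T) := fun j hj' =>
    continuousOn_const.mul (continuousOn_rlIntegral (hj j hj') continuousOn_const)
  unfold fracTaylor
  rw [rlIntegral_add hδ (continuousOn_finsetSum _ hcj)
    (continuousOn_rlIntegral (by linarith) hg) ht, rlIntegral_sum hδ _ hcj ht,
    rlIntegral_rlIntegral hδ (by linarith) hg ht]
  congr 1
  · refine Finset.sum_congr rfl fun j hj' => ?_
    rw [rlIntegral_const_mul, rlIntegral_rlIntegral hδ (hj j hj') continuousOn_const ht]
    ring_nf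
  · ring_nf

theorem fracTaylor_nat_zero {k : ℕ} (hk : k < ⌈α₀⌉₊) : fracTaylor α₀ c g k k 0 = c k := by
  have hα : (k : ℝ) < α₀ := Nat.lt_ceil.1 hk
  simp only [fracTaylor]
  rw [Finset.sum_eq_sum_Ico_succ_bot hk, sub_self, rlIntegral_zero_order,
    rlIntegral_at_zero (sub_pos.2 hα).ne',
    Finset.sum_eq_zero, mul_one, add_zero, add_zero]
  intro j hj
  have : (k : ℝ) < j := by exact_mod_cast (Finset.mem_Ico.1 hj).1
  rw [rlIntegral_at_zero (sub_pos.2 this).ne', mul_zero]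

theorem fracTaylor_zero_zero {t : ℝ} (ht : 0 ≤ t) :
    fracTaylor α₀ c g 0 0 t = ∑ j ∈ Finset.range ⌈α₀⌉₊, c j * Phi j t + rlIntegral α₀ g t := by
  simp only [fracTaylor, sub_zero, Finset.range_eq_Ico, rlIntegral_const_one_nat _ ht]

variable {y : ℝ → ℝ}

theorem iteratedDerivWithin_of_eqOn_fracTaylor (hT : 0 < T) (hg : ContinuousOn g (Icc 0 T))
    (hy : EqOn y (fracTaylor α₀ c g 0 0) (Icc 0 T)) {k : ℕ} (hk : k < ⌈α₀⌉₊) :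
    EqOn (iteratedDerivWithin k y (Icc 0 T)) (fracTaylor α₀ c g k k) (Icc 0 T) :=
  iteratedDerivWithin_eqOn_of_chain (uniqueDiffOn_Icc hT) (n := ⌈α₀⌉₊ - 1)
    (u := fun k => fracTaylor α₀ c g k k) (by simpa using hy)
    (fun k hk t ht => hasDerivWithinAt_fracTaylor_nat hg (by omega) ht) k (by omega)

theorem contDiffOn_of_eqOn_fracTaylor (hT : 0 < T) (hα : 0 < α₀) (hg : ContinuousOn g (Icc 0 T))
    (hy : EqOn y (fracTaylor α₀ c g 0 0) (Icc 0 T)) :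
    ContDiffOn ℝ (⌈α₀⌉₊ - 1 : ℕ) y (Icc 0 T) := by
  have hn : 0 < ⌈α₀⌉₊ := Nat.ceil_pos.2 hα
  refine contDiffOn_of_chain (uniqueDiffOn_Icc hT)
    (u := fun k => fracTaylor α₀ c g k k) (by simpa using hy)
    (fun k hk t ht => hasDerivWithinAt_fracTaylor_nat hg (by omega) ht)
    (continuousOn_fracTaylor hg le_rfl (Nat.lt_ceil.1 (by omega)).le)

/-- The `k`-th derivative at 0 is `c k`, because all other terms are integrals of positive order.
Removing the Taylor polynomial therefore only raises the cutoff from 0 to `n`. -/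
theorem taylorRemainder_of_eqOn_fracTaylor (hT : 0 < T) (hg : ContinuousOn g (Icc 0 T))
    (hy : EqOn y (fracTaylor α₀ c g 0 0) (Icc 0 T)) {n : ℕ} (hn : n ≤ ⌈α₀⌉₊) :
    EqOn (taylorRemainder T n y) (fracTaylor α₀ c g n 0) (Icc 0 T) := by
  intro t ht
  have h : ∀ k ∈ Finset.range n, iteratedDerivWithin k y (Icc 0 T) 0 / (Nat.factorial k : ℝ) * t ^ k
      = c k * rlIntegral (k - 0) (fun _ => 1) t := by
    intro k hk
    have hk' : k < ⌈α₀⌉₊ := (Finset.mem_range.1 hk).trans_le hn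
    rw [iteratedDerivWithin_of_eqOn_fracTaylor hT hg hy hk' ⟨le_rfl, hT.le⟩,
      fracTaylor_nat_zero hk', sub_zero, rlIntegral_const_one_nat _ ht.1, Phi]
    ring
  rw [taylorRemainder, Finset.sum_congr rfl h, hy ht, fracTaylor, fracTaylor,
    Finset.range_eq_Ico, ← Finset.sum_Ico_consecutive _ (Nat.zero_le n) hn]
  ring

/-- Start of the derivative chain for `ᶜD^β`: the integral shifts the order down to `β - ⌈β⌉`, and
`⌈β⌉` derivatives bring it back to `β`. The summand `(0 : ℕ)` matches the chain at `k = 0`. -/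
theorem rlIntegral_taylorRemainder_of_eqOn_fracTaylor (hT : 0 < T) (hα : 0 ≤ α₀)
    (hg : ContinuousOn g (Icc 0 T)) (hy : EqOn y (fracTaylor α₀ c g 0 0) (Icc 0 T)) {β : ℝ}
    (hβα : β ≤ α₀) :
    EqOn (rlIntegral ((⌈β⌉₊ : ℝ) - β) (taylorRemainder T ⌈β⌉₊ y))
      (fracTaylor α₀ c g ⌈β⌉₊ (β - ⌈β⌉₊ + (0 : ℕ))) (Ioo 0 T) := by
  intro t ht
  have ht' := Ioo_subset_Icc_self ht
  rw [rlIntegral_congr (taylorRemainder_of_eqOn_fracTaylor hT hg hy (Nat.ceil_mono hβα)) ht',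
    rlIntegral_fracTaylor hg (Nat.cast_nonneg _) hα (sub_nonneg.2 (Nat.le_ceil β)) ht']
  push_cast
  ring_nf

theorem hasDerivAt_fracTaylor_ceil (hg : ContinuousOn g (Icc 0 T)) {β : ℝ} (hβα : β ≤ α₀) :
    ∀ k < ⌈β⌉₊, ∀ t ∈ Ioo 0 T, HasDerivAt (fracTaylor α₀ c g ⌈β⌉₊ (β - ⌈β⌉₊ + k))
      (fracTaylor α₀ c g ⌈β⌉₊ (β - ⌈β⌉₊ + (k + 1 : ℕ)) t) t := by
  intro k hk t ht
  have hceil := Nat.le_ceil β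
  have hceil' := Nat.ceil_lt_add_one (Nat.ceil_pos.1 (Nat.zero_lt_of_lt hk)).le
  have hk' : (k : ℝ) + 1 ≤ ⌈β⌉₊ := by exact_mod_cast hk
  have := hasDerivWithinAt_fracTaylor (c := c) hg (p := ⌈β⌉₊) (β := β - ⌈β⌉₊ + k) (by linarith)
    (by linarith : _ ≤ α₀) (Ioo_subset_Icc_self ht)
  rw [add_assoc] at this
  push_cast
  exact this.hasDerivAt (Icc_mem_nhds ht.1 ht.2)

theorem caputoDifferentiableOn_of_eqOn_fracTaylor (hT : 0 < T) (hα : 0 ≤ α₀)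
    (hg : ContinuousOn g (Icc 0 T)) (hy : EqOn y (fracTaylor α₀ c g 0 0) (Icc 0 T)) {β : ℝ}
    (hβα : β ≤ α₀) : CaputoDifferentiableOn T β y :=
  differentiableAt_iteratedDeriv_of_chain isOpen_Ioo
    (u := fun k => fracTaylor α₀ c g ⌈β⌉₊ (β - ⌈β⌉₊ + k))
    (rlIntegral_taylorRemainder_of_eqOn_fracTaylor hT hα hg hy hβα)
    (hasDerivAt_fracTaylor_ceil hg hβα)

theorem caputo_of_eqOn_fracTaylor (hT : 0 < T) (hα : 0 ≤ α₀)
    (hg : ContinuousOn g (Icc 0 T)) (hy : EqOn y (fracTaylor α₀ c g 0 0) (Icc 0 T)) {β : ℝ}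
    (hβα : β ≤ α₀) : EqOn (caputo T β y) (fracTaylor α₀ c g ⌈β⌉₊ β) (Ioo 0 T) := by
  have h := iteratedDeriv_eqOn_of_chain isOpen_Ioo
    (u := fun k => fracTaylor α₀ c g ⌈β⌉₊ (β - ⌈β⌉₊ + k))
    (rlIntegral_taylorRemainder_of_eqOn_fracTaylor hT hα hg hy hβα)
    (hasDerivAt_fracTaylor_ceil hg hβα) ⌈β⌉₊ le_rfl
  rw [sub_add_cancel] at h
  exact h

theorem fracTaylor_self_order (t : ℝ) : fracTaylor α₀ c g ⌈α₀⌉₊ α₀ t = g t := by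
  simp [fracTaylor, rlIntegral_zero_order]

theorem memCalpha_of_eqOn_fracTaylor (hT : 0 < T) (hα : 0 < α₀)
    (hg : ContinuousOn g (Icc 0 T)) (hy : EqOn y (fracTaylor α₀ c g 0 0) (Icc 0 T)) :
    MemCalpha T α₀ (⌈α₀⌉₊ - 1) y :=
  ⟨contDiffOn_of_eqOn_fracTaylor hT hα hg hy,
    caputoDifferentiableOn_of_eqOn_fracTaylor hT hα.le hg hy le_rfl, g, hg, fun t ht => by
      rw [caputo_of_eqOn_fracTaylor hT hα.le hg hy le_rfl ht, fracTaylor_self_order]⟩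

theorem hasInitialValues_of_eqOn_fracTaylor (hT : 0 < T)
    (hg : ContinuousOn g (Icc 0 T)) (hy : EqOn y (fracTaylor α₀ c g 0 0) (Icc 0 T)) :
    HasInitialValues T ⌈α₀⌉₊ c y := by
  intro k hk
  have h := iteratedDerivWithin_of_eqOn_fracTaylor hT hg hy hk
  have h0 : (0 : ℝ) ∈ Icc 0 T := ⟨le_rfl, hT.le⟩
  have hc := (continuousOn_fracTaylor (c := c) hg le_rfl (Nat.lt_ceil.1 hk).le).congr h 0 h0
  rw [ContinuousWithinAt, h h0, fracTaylor_nat_zero hk] at hc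
  refine hc.mono_left ?_
  rw [← nhdsWithin_Ioc_eq_nhdsGT hT]
  exact nhdsWithin_mono _ Ioc_subset_Icc_self

/-- Every function with a continuous Caputo derivative `g` of order `α₀` is the sum of its Taylor
polynomial at `0` and of `I^{α₀} g`. -/
theorem eqOn_fracTaylor_of_caputo (hT : 0 < T) (hα : 0 < α₀)
    (hy : ContDiffOn ℝ (⌈α₀⌉₊ - 1 : ℕ) y (Icc 0 T)) (hd : CaputoDifferentiableOn T α₀ y)
    (hg : ContinuousOn g (Icc 0 T)) (hcap : EqOn (caputo T α₀ y) g (Ioo 0 T))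
    (hc : ∀ k < ⌈α₀⌉₊, iteratedDerivWithin k y (Icc 0 T) 0 = c k) :
    EqOn y (fracTaylor α₀ c g 0 0) (Icc 0 T) := by
  have hu := uniqueDiffOn_Icc hT
  have h0T : (0 : ℝ) ∈ Icc 0 T := ⟨le_rfl, hT.le⟩
  obtain ⟨n, hn⟩ : ∃ n, ⌈α₀⌉₊ = n + 1 := Nat.exists_eq_succ_of_ne_zero (Nat.ceil_pos.2 hα).ne'
  have hle : α₀ ≤ n + 1 := by have := Nat.le_ceil α₀; rw [hn] at this; exact_mod_cast this
  have hlt : (n : ℝ) < α₀ := Nat.lt_ceil.1 (by omega)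
  have hz : ContinuousOn (fun _ : ℝ => (0 : ℝ)) (Icc 0 T) := continuousOn_const
  -- `P` is the Taylor polynomial, written with zero density so that the derivative formulas above
  -- apply to it.
  set P := fracTaylor α₀ c (fun _ => 0) 0 0 with hP
  set R := taylorRemainder T (n + 1) y with hR
  have hPe : EqOn P (fracTaylor α₀ c (fun _ => 0) 0 0) (Icc 0 T) := fun _ _ => rfl
  have hRP : EqOn R (y - P) (Icc 0 T) := by
    intro t ht
    simp only [Pi.sub_apply, hR, hP, taylorRemainder, fracTaylor_zero_zero ht.1, hn,
      rlIntegral_zero_fun, add_zero]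
    congr 1
    refine Finset.sum_congr rfl fun k hk => ?_
    rw [hc k (by rw [hn]; exact Finset.mem_range.1 hk), Phi]
    ring
  have hPd := contDiffOn_of_eqOn_fracTaylor hT hα hz hPe
  rw [hn, Nat.add_sub_cancel] at hy hPd
  have hRd : ContDiffOn ℝ n R (Icc 0 T) := (hy.sub hPd).congr hRP
  have hR0 : ∀ k < n + 1, iteratedDerivWithin k R (Icc 0 T) 0 = 0 := by
    intro k hk
    have hkn : (k : WithTop ℕ∞) ≤ n := by exact_mod_cast Nat.lt_succ_iff.1 hk
    rw [iteratedDerivWithin_congr hRP h0T, iteratedDerivWithin_sub h0T hu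
      ((hy 0 h0T).of_le hkn) ((hPd 0 h0T).of_le hkn), hc k (by omega),
      iteratedDerivWithin_of_eqOn_fracTaylor hT hz hPe (by omega) h0T,
      fracTaylor_nat_zero (by omega), sub_self]
  -- Since `y` is only known to be `C^n` with `n = n₀ - 1`, the remainder is written as `R = I^n r`.
  -- Then the `n`-th derivative of `I^{n₀-α₀} R` is `q = I^{n₀-α₀} r`, and one more derivative gives
  -- `g`.
  set r := iteratedDerivWithin n R (Icc 0 T) with hr
  have hrc : ContinuousOn r (Icc 0 T) := hRd.continuousOn_iteratedDerivWithin le_rfl hu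
  have hRr : EqOn R (rlIntegral n r) (Icc 0 T) :=
    eqOn_rlIntegral_iteratedDerivWithin hT hRd fun k hk => hR0 k (by omega)
  have hδ : 0 ≤ (n : ℝ) + 1 - α₀ := by linarith
  set F := rlIntegral ((n : ℝ) + 1 - α₀) R with hF
  have hFr : EqOn F (rlIntegral ((n : ℝ) + 1 - α₀ + (n - (0 : ℕ))) r) (Ioo 0 T) := by
    intro t ht
    have ht' := Ioo_subset_Icc_self ht
    rw [hF, rlIntegral_congr hRr ht', rlIntegral_rlIntegral hδ n.cast_nonneg hrc ht']
    simp
  have hchain := iteratedDeriv_eqOn_of_chain isOpen_Ioo (n := n)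
    (u := fun k => rlIntegral ((n : ℝ) + 1 - α₀ + (n - k)) r) hFr (fun k hk t ht => by
      have hk' : (k : ℝ) + 1 ≤ n := by exact_mod_cast hk
      have := hasDerivWithinAt_rlIntegral (γ := (n : ℝ) + 1 - α₀ + (n - (k + 1 : ℕ)))
        (by push_cast; linarith) hrc (Ioo_subset_Icc_self ht)
      rw [show (n : ℝ) + 1 - α₀ + (n - (k + 1 : ℕ)) + 1 = (n : ℝ) + 1 - α₀ + (n - k) by
        push_cast; ring] at this
      exact this.hasDerivAt (Icc_mem_nhds ht.1 ht.2)) n le_rfl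
  simp only [sub_self, add_zero] at hchain
  set q := rlIntegral ((n : ℝ) + 1 - α₀) r with hq
  have hqc : ContinuousOn q (Icc 0 T) := continuousOn_rlIntegral hδ hrc
  have hq0 : q 0 = 0 := by
    -- For integer `α₀` one has `q = r`, which vanishes at 0 as the `n`-th derivative of the
    -- remainder; otherwise the integral has positive order.
    rcases eq_or_ne ((n : ℝ) + 1 - α₀) 0 with h | h
    · rw [hq, h, rlIntegral_zero_order]
      exact hR0 n n.lt_succ_self
    · exact rlIntegral_at_zero h r
  have hqd : ∀ t ∈ Ioo 0 T, HasDerivAt q (g t) t := by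
    intro t ht
    have hev := hchain.eventuallyEq_of_mem (isOpen_Ioo.mem_nhds ht)
    have hdiff : DifferentiableAt ℝ (iteratedDeriv n F) t := by
      have := hd n (by omega) t ht
      rwa [hn, Nat.cast_add_one] at this
    have hval : deriv (iteratedDeriv n F) t = g t := by
      rw [← hcap ht, ← iteratedDeriv_succ, caputo, rlDeriv, hn, Nat.cast_add_one]
    rw [← hval]
    exact hdiff.hasDerivAt.congr_of_eventuallyEq hev.symm
  have hqg : EqOn q (rlIntegral 1 g) (Icc 0 T) := by
    intro t ht
    have hsub : Icc 0 t ⊆ Icc 0 T := Icc_subset_Icc le_rfl ht.2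
    rw [rlIntegral_one, intervalIntegral.integral_eq_sub_of_hasDerivAt_of_le ht.1 (hqc.mono hsub)
      (fun s hs => hqd s ⟨hs.1, hs.2.trans_le ht.2⟩)
      (ContinuousOn.intervalIntegrable (by rw [uIcc_of_le ht.1]; exact hg.mono hsub)),
      hq0, sub_zero]
  -- Applying `I^{α₀-n}` to `I^{n+1-α₀} r = I^1 g` gives `I^1 r = I^1 I^{α₀-n} g`, and `I^1` is
  -- injective on continuous functions.
  have hrg : EqOn r (rlIntegral (α₀ - n) g) (Icc 0 T) := by
    refine eqOn_of_rlIntegral_one_eqOn hT hrc (continuousOn_rlIntegral (by linarith) hg) ?_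
    intro t ht
    have h1 := rlIntegral_rlIntegral (γ := α₀ - n) (by linarith) hδ hrc ht
    rw [rlIntegral_congr hqg ht, rlIntegral_rlIntegral (by linarith) zero_le_one hg ht,
      show α₀ - n + ((n : ℝ) + 1 - α₀) = 1 by ring] at h1
    rw [← h1, rlIntegral_rlIntegral zero_le_one (by linarith) hg ht, add_comm]
  intro t ht
  have h1 := hRP ht
  rw [hRr ht, rlIntegral_congr hrg ht,
    rlIntegral_rlIntegral n.cast_nonneg (by linarith) hg ht, add_sub_cancel] at h1
  rw [fracTaylor_zero_zero ht.1, h1]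
  simp [hP, fracTaylor_zero_zero ht.1, rlIntegral_zero_fun]

end FracTaylor

/-! ### The Volterra operator `L = ∑ a_i I^{α₀-α_i}` and its Neumann series. -/

section Volterra

variable {T : ℝ} {m : ℕ} {α : ℕ → ℝ} {a : ℕ → ℝ → ℝ}

/-- Integrals of positive order ignore the value at 0. This matters because `PhiFrac` is controlled
only for `t > 0`. -/
theorem opL_congr (hα : ∀ i ∈ Finset.Icc 1 m, α i < α 0) {f g : ℝ → ℝ}
    (h : EqOn f g (Ioc 0 T)) : EqOn (opL m α a f) (opL m α a g) (Icc 0 T) := by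
  intro t ht
  refine Finset.sum_congr rfl fun i hi => ?_
  rw [rlIntegral_congr_of_ne (sub_pos.2 (hα i hi)).ne' ht.1 fun s hs =>
    h ⟨hs.1, hs.2.le.trans ht.2⟩]

theorem opL_iterate_congr (hα : ∀ i ∈ Finset.Icc 1 m, α i < α 0) {f g : ℝ → ℝ}
    (h : EqOn f g (Ioc 0 T)) (k : ℕ) :
    EqOn ((opL m α a)^[k] f) ((opL m α a)^[k] g) (Ioc 0 T) := by
  induction k with
  | zero => exact h
  | succ k ih =>
    rw [Function.iterate_succ_apply', Function.iterate_succ_apply']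
    exact (opL_congr hα ih).mono Ioc_subset_Icc_self

theorem continuousOn_opL (hα : ∀ i ∈ Finset.Icc 1 m, α i < α 0)
    (ha : ∀ i ∈ Finset.Icc 1 m, ContinuousOn (a i) (Icc 0 T)) {f : ℝ → ℝ}
    (hf : ContinuousOn f (Icc 0 T)) : ContinuousOn (opL m α a f) (Icc 0 T) :=
  continuousOn_finsetSum _ fun i hi =>
    (ha i hi).mul (continuousOn_rlIntegral (sub_pos.2 (hα i hi)).le hf)

theorem continuousOn_opL_iterate (hα : ∀ i ∈ Finset.Icc 1 m, α i < α 0)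
    (ha : ∀ i ∈ Finset.Icc 1 m, ContinuousOn (a i) (Icc 0 T)) {f : ℝ → ℝ}
    (hf : ContinuousOn f (Icc 0 T)) (k : ℕ) :
    ContinuousOn ((opL m α a)^[k] f) (Icc 0 T) := by
  induction k with
  | zero => exact hf
  | succ k ih =>
    rw [Function.iterate_succ_apply']
    exact continuousOn_opL hα ha ih

theorem opL_const_mul (c : ℝ) (f : ℝ → ℝ) (t : ℝ) :
    opL m α a (fun s => c * f s) t = c * opL m α a f t := by
  simp only [opL, rlIntegral_const_mul, Finset.mul_sum, mul_left_comm]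

theorem opL_sub (hα : ∀ i ∈ Finset.Icc 1 m, α i < α 0) {f g : ℝ → ℝ}
    (hf : ContinuousOn f (Icc 0 T)) (hg : ContinuousOn g (Icc 0 T)) {t : ℝ} (ht : t ∈ Icc 0 T) :
    opL m α a (fun s => f s - g s) t = opL m α a f t - opL m α a g t := by
  simp only [opL, ← Finset.sum_sub_distrib]
  refine Finset.sum_congr rfl fun i hi => ?_
  rw [rlIntegral_sub (sub_pos.2 (hα i hi)).le hf hg ht, mul_sub]

theorem opL_sum {ι : Type*} (hα : ∀ i ∈ Finset.Icc 1 m, α i < α 0) (s : Finset ι)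
    {f : ι → ℝ → ℝ} (hf : ∀ j ∈ s, ContinuousOn (f j) (Icc 0 T)) {t : ℝ} (ht : t ∈ Icc 0 T) :
    opL m α a (fun x => ∑ j ∈ s, f j x) t = ∑ j ∈ s, opL m α a (f j) t := by
  simp only [opL]
  rw [Finset.sum_comm]
  refine Finset.sum_congr rfl fun i hi => ?_
  rw [rlIntegral_sum (sub_pos.2 (hα i hi)).le s hf ht, Finset.mul_sum]

/-- With bounds `A i` for `|a i|`, the norm of `L` is at most `∑ A i * l ^ (-(α 0 - α i))`, which
tends to 0 as `l → ∞`; any `l` making it less than 1/2 will do. -/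
theorem exists_opL_contraction (hα : ∀ i ∈ Finset.Icc 1 m, α i < α 0)
    (ha : ∀ i ∈ Finset.Icc 1 m, ContinuousOn (a i) (Icc 0 T)) :
    ∃ l : ℝ, 0 < l ∧ ∀ M, 0 ≤ M → ∀ f : ℝ → ℝ,
      (∀ s ∈ Icc 0 T, |f s| ≤ M * Real.exp (l * s)) →
      ∀ t ∈ Icc 0 T, |opL m α a f t| ≤ M * (1 / 2) * Real.exp (l * t) := by
  have hA : ∀ i, ∃ A : ℝ, i ∈ Finset.Icc 1 m → ∀ t ∈ Icc 0 T, |a i t| ≤ A := fun i => by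
    by_cases hi : i ∈ Finset.Icc 1 m
    · obtain ⟨A, hA⟩ := isCompact_Icc.exists_bound_of_continuousOn (ha i hi)
      exact ⟨A, fun _ => hA⟩
    · exact ⟨0, fun h => absurd h hi⟩
  choose A hA using hA
  have hlim : Tendsto (fun l : ℝ => ∑ i ∈ Finset.Icc 1 m, A i * l ^ (-(α 0 - α i))) atTop (𝓝 0) := by
    have := tendsto_finsetSum (Finset.Icc 1 m) fun i hi =>
      (tendsto_rpow_neg_atTop (sub_pos.2 (hα i hi))).const_mul (A i)
    simpa using this
  obtain ⟨l, hl, hl0⟩ := ((hlim.eventually_lt_const (show (0 : ℝ) < 1 / 2 by norm_num)).and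
    (eventually_gt_atTop 0)).exists
  refine ⟨l, hl0, fun M hM f hf t ht => ?_⟩
  calc |opL m α a f t| ≤ ∑ i ∈ Finset.Icc 1 m, |a i t * rlIntegral (α 0 - α i) f t| :=
        Finset.abs_sum_le_sum_abs _ _
    _ ≤ ∑ i ∈ Finset.Icc 1 m, A i * (M * l ^ (-(α 0 - α i)) * Real.exp (l * t)) := by
        refine Finset.sum_le_sum fun i hi => ?_
        rw [abs_mul]
        exact mul_le_mul (hA i hi t ht) (abs_rlIntegral_le (sub_pos.2 (hα i hi)).le hl0 hM ht.1
          fun s hs => hf s ⟨hs.1, hs.2.trans ht.2⟩) (abs_nonneg _)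
          ((abs_nonneg _).trans (hA i hi t ht))
    _ = M * (∑ i ∈ Finset.Icc 1 m, A i * l ^ (-(α 0 - α i))) * Real.exp (l * t) := by
        rw [Finset.mul_sum, Finset.sum_mul]
        exact Finset.sum_congr rfl fun i _ => by ring
    _ ≤ M * (1 / 2) * Real.exp (l * t) := by gcongr

/-- At a maximum point of `|u(s)| e^{-l s}` the contraction gives `M ≤ M / 2` for the maximum `M`,
so `M = 0`. -/
theorem eq_zero_of_eq_neg_opL (hT : 0 < T) (hα : ∀ i ∈ Finset.Icc 1 m, α i < α 0)
    (ha : ∀ i ∈ Finset.Icc 1 m, ContinuousOn (a i) (Icc 0 T)) {u : ℝ → ℝ}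
    (hu : ContinuousOn u (Icc 0 T)) (h : ∀ t ∈ Ioo 0 T, u t = -opL m α a u t) :
    EqOn u (fun _ => 0) (Icc 0 T) := by
  have h' : EqOn u (fun t => -opL m α a u t) (Icc 0 T) :=
    EqOn.of_subset_closure h hu (continuousOn_opL hα ha hu).neg Ioo_subset_Icc_self
      (by rw [closure_Ioo hT.ne])
  obtain ⟨l, hl, hL⟩ := exists_opL_contraction hα ha
  obtain ⟨s₀, hs₀, hmax⟩ := isCompact_Icc.exists_isMaxOn (nonempty_Icc.2 hT.le)
    (show ContinuousOn (fun s => |u s| * Real.exp (-(l * s))) (Icc 0 T) by fun_prop)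
  have hexp : ∀ s, Real.exp (-(l * s)) * Real.exp (l * s) = 1 := fun s => by
    rw [← Real.exp_add, neg_add_cancel, Real.exp_zero]
  set M := |u s₀| * Real.exp (-(l * s₀)) with hM
  have hM0 : 0 ≤ M := by positivity
  have hbound : ∀ s ∈ Icc 0 T, |u s| ≤ M * Real.exp (l * s) := fun s hs => by
    have := mul_le_mul_of_nonneg_right (hmax hs) (Real.exp_pos (l * s)).le
    simp only at this
    rwa [mul_assoc, hexp, mul_one] at this
  have h1 := hL M hM0 u hbound s₀ hs₀
  rw [← abs_neg, show -opL m α a u s₀ = u s₀ from (h' hs₀).symm] at h1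
  have h2 := mul_le_mul_of_nonneg_right h1 (Real.exp_pos (-(l * s₀))).le
  rw [← hM, mul_assoc _ (Real.exp _), mul_comm (Real.exp _), hexp] at h2
  have hM0' : M = 0 := by linarith
  intro t ht
  have := hbound t ht
  rw [hM0', zero_mul] at this
  exact abs_nonpos_iff.1 this

/-- The Volterra equation `g = -S - L g` is solved by its Neumann series. -/
theorem exists_neumann_series (hα : ∀ i ∈ Finset.Icc 1 m, α i < α 0)
    (ha : ∀ i ∈ Finset.Icc 1 m, ContinuousOn (a i) (Icc 0 T)) {S : ℝ → ℝ}
    (hS : ContinuousOn S (Icc 0 T)) :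
    ∃ g : ℝ → ℝ, ContinuousOn g (Icc 0 T) ∧ (∀ t ∈ Icc 0 T, g t = -S t - opL m α a g t) ∧
      ∀ γ, 0 ≤ γ → ∀ t ∈ Icc 0 T,
        HasSum (fun k => (-1) ^ (k + 1) * rlIntegral γ ((opL m α a)^[k] S) t)
          (rlIntegral γ g t) := by
  obtain ⟨l, hl, hL⟩ := exists_opL_contraction hα ha
  obtain ⟨M, hM⟩ := isCompact_Icc.exists_bound_of_continuousOn hS
  have hbound : ∀ k : ℕ, ∀ t ∈ Icc 0 T,
      |(opL m α a)^[k] S t| ≤ |M| * (1 / 2) ^ k * Real.exp (l * t) := by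
    intro k
    induction k with
    | zero =>
      intro t ht
      have h1 : |S t| ≤ |M| := (hM t ht).trans (le_abs_self M)
      have h2 : 1 ≤ Real.exp (l * t) := Real.one_le_exp (mul_nonneg hl.le ht.1)
      simpa using h1.trans (le_mul_of_one_le_right (abs_nonneg M) h2)
    | succ k ih =>
      intro t ht
      rw [Function.iterate_succ_apply', pow_succ, ← mul_assoc]
      exact hL _ (by positivity) _ ih t ht
  set f : ℕ → ℝ → ℝ := fun k t => (-1) ^ (k + 1) * (opL m α a)^[k] S t with hf
  set C := |M| * Real.exp (l * T) with hC
  have hfc : ∀ k, ContinuousOn (f k) (Icc 0 T) := fun k =>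
    continuousOn_const.mul (continuousOn_opL_iterate hα ha hS k)
  have hfb : ∀ k, ∀ s ∈ Icc 0 T, |f k s| ≤ C * (1 / 2) ^ k := by
    intro k s hs
    rw [hf, abs_mul, abs_pow, abs_neg, abs_one, one_pow, one_mul]
    refine (hbound k s hs).trans ?_
    rw [hC, mul_right_comm]
    have := hs.2
    gcongr
  have hgeo : Summable fun k : ℕ => C * (1 / 2 : ℝ) ^ k :=
    (summable_geometric_of_lt_one (by norm_num) (by norm_num)).mul_left C
  have hsum : ∀ s ∈ Icc 0 T, HasSum (fun k => f k s) (∑' k, f k s) := fun s hs =>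
    (hgeo.of_norm_bounded (fun k => hfb k s hs)).hasSum
  have hI : ∀ γ, 0 ≤ γ → ∀ t ∈ Icc 0 T,
      HasSum (fun k => rlIntegral γ (f k) t) (rlIntegral γ (fun s => ∑' k, f k s) t) :=
    fun γ hγ t ht => hasSum_rlIntegral hγ (by norm_num) (by norm_num) hfc hfb hsum ht
  refine ⟨fun s => ∑' k, f k s, continuousOn_tsum hfc hgeo fun k s hs => hfb k s hs, ?_, ?_⟩
  · intro t ht
    have h1 : HasSum (fun k => opL m α a (f k) t) (opL m α a (fun s => ∑' k, f k s) t) :=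
      hasSum_sum fun i hi => (hI _ (sub_pos.2 (hα i hi)).le t ht).mul_left _
    -- The signed terms satisfy `f (k + 1) = -L (f k)` and `f 0 = -S`; splitting off the first term
    -- of the sum gives the Volterra equation.
    have h2 : ∀ k, f (k + 1) t = -opL m α a (f k) t := fun k => by
      rw [hf]
      simp only
      rw [opL_const_mul, Function.iterate_succ_apply', pow_succ (-1 : ℝ) (k + 1)]
      ring
    have h3 : HasSum (fun k => f (k + 1) t) (-opL m α a (fun s => ∑' k, f k s) t) := by
      simpa only [h2] using h1.neg
    have h4 := (hsum t ht).unique ((hasSum_nat_add_iff 1).1 h3)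
    simp only [h4, Finset.sum_range_one]
    simp only [hf, Function.iterate_zero, id]
    ring
  · intro γ hγ t ht
    have := hI γ hγ t ht
    simpa only [hf, rlIntegral_const_mul] using this

end Volterra

/-! ### Equivalence of the initial value problem and the Volterra equation. -/

section Equation

variable {T : ℝ} {m : ℕ} {α : ℕ → ℝ} {a : ℕ → ℝ → ℝ}

/-- The contribution `∑ a_i ᶜD^{α_i} ∑_j c_j Φ_{j+1}` of the Taylor polynomial to the equation. -/
noncomputable def taylorSource (m : ℕ) (α : ℕ → ℝ) (a : ℕ → ℝ → ℝ) (c : ℕ → ℝ) (t : ℝ) : ℝ :=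
  ∑ i ∈ Finset.Icc 1 m, a i t *
    ∑ j ∈ Finset.Ico ⌈α i⌉₊ ⌈α 0⌉₊, c j * rlIntegral (j - α i) (fun _ => 1) t

theorem continuousOn_taylorSource (ha : ∀ i ∈ Finset.Icc 1 m, ContinuousOn (a i) (Icc 0 T))
    (c : ℕ → ℝ) : ContinuousOn (taylorSource m α a c) (Icc 0 T) := by
  refine continuousOn_finsetSum _ fun i hi => (ha i hi).mul
    (continuousOn_finsetSum _ fun j hj => continuousOn_const.mul
      (continuousOn_rlIntegral (sub_nonneg.2 ?_) continuousOn_const))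
  exact Nat.ceil_le.1 (Finset.mem_Ico.1 hj).1

theorem taylorSource_eq_sum (b : ℕ → ℝ) (t : ℝ) :
    taylorSource m α a b t = ∑ j ∈ Finset.range ⌈α 0⌉₊,
      b j * taylorSource m α a (fun k => if j = k then 1 else 0) t := by
  simp only [taylorSource, Finset.mul_sum]
  rw [Finset.sum_comm]
  refine Finset.sum_congr rfl fun i _ => ?_
  rw [Finset.sum_comm]
  refine Finset.sum_congr rfl fun k hk => ?_
  have hk' : k ∈ Finset.range ⌈α 0⌉₊ := Finset.mem_range.2 (Finset.mem_Ico.1 hk).2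
  rw [Finset.sum_eq_single_of_mem k hk' fun j _ hjk => by simp [hjk]]
  simp only [if_true]
  ring

theorem sum_mul_fracTaylor (c : ℕ → ℝ) (g : ℝ → ℝ) (t : ℝ) :
    ∑ i ∈ Finset.Icc 1 m, a i t * fracTaylor (α 0) c g ⌈α i⌉₊ (α i) t =
      taylorSource m α a c t + opL m α a g t := by
  simp only [fracTaylor, taylorSource, opL, ← Finset.sum_add_distrib, mul_add]

theorem isIVPSolution_of_eqOn_fracTaylor (hT : 0 < T) (hα0 : 0 < α 0)
    (hα : ∀ i ∈ Finset.Icc 1 m, α i < α 0) {c : ℕ → ℝ} {g y : ℝ → ℝ}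
    (hg : ContinuousOn g (Icc 0 T)) (hy : EqOn y (fracTaylor (α 0) c g 0 0) (Icc 0 T))
    (hgeq : ∀ t ∈ Ioo 0 T, g t = -taylorSource m α a c t - opL m α a g t) :
    IsIVPSolution T m α a c y := by
  have hle : ∀ i ≤ m, α i ≤ α 0 := fun i hi => by
    rcases Nat.eq_zero_or_pos i with rfl | h
    · exact le_rfl
    · exact (hα i (Finset.mem_Icc.2 ⟨h, hi⟩)).le
  refine ⟨memCalpha_of_eqOn_fracTaylor hT hα0 hg hy, ⟨fun i hi =>
    caputoDifferentiableOn_of_eqOn_fracTaylor hT hα0.le hg hy (hle i hi), fun t ht => ?_⟩,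
    hasInitialValues_of_eqOn_fracTaylor hT hg hy⟩
  rw [caputo_of_eqOn_fracTaylor hT hα0.le hg hy le_rfl ht, fracTaylor_self_order,
    Finset.sum_congr rfl fun i hi => by
      rw [caputo_of_eqOn_fracTaylor hT hα0.le hg hy (hle i (Finset.mem_Icc.1 hi).2) ht],
    sum_mul_fracTaylor, hgeq t ht]
  ring

theorem exists_eqOn_fracTaylor_of_isIVPSolution (hT : 0 < T) (hα0 : 0 < α 0)
    (hα : ∀ i ∈ Finset.Icc 1 m, α i < α 0) {b : ℕ → ℝ} {z : ℝ → ℝ}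
    (hz : IsIVPSolution T m α a b z) :
    ∃ g : ℝ → ℝ, ContinuousOn g (Icc 0 T) ∧ EqOn z (fracTaylor (α 0) b g 0 0) (Icc 0 T) ∧
      ∀ t ∈ Ioo 0 T, g t = -taylorSource m α a b t - opL m α a g t := by
  obtain ⟨⟨hzd, hcd, g, hg, hgz⟩, ⟨-, heq⟩, hinit⟩ := hz
  have h0T : (0 : ℝ) ∈ Icc 0 T := ⟨le_rfl, hT.le⟩
  -- The derivatives are continuous on `[0, T]`, so the limits at `+0` are the values at 0 used in
  -- the Taylor polynomial.
  have hc : ∀ k < ⌈α 0⌉₊, iteratedDerivWithin k z (Icc 0 T) 0 = b k := by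
    intro k hk
    have hcont := hzd.continuousOn_iteratedDerivWithin (m := k)
      (by exact_mod_cast Nat.le_sub_one_of_lt hk) (uniqueDiffOn_Icc hT) 0 h0T
    refine tendsto_nhds_unique (hcont.mono_left ?_) (hinit k hk)
    rw [← nhdsWithin_Ioc_eq_nhdsGT hT]
    exact nhdsWithin_mono _ Ioc_subset_Icc_self
  have hrep := eqOn_fracTaylor_of_caputo hT hα0 hzd hcd hg hgz hc
  refine ⟨g, hg, hrep, fun t ht => ?_⟩
  rw [← hgz ht, heq t ht, Finset.sum_congr rfl fun i hi => by
    rw [caputo_of_eqOn_fracTaylor hT hα0.le hg hrep (hα i hi).le ht], sum_mul_fracTaylor]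
  ring

/-- Since `Φ_{j+1} = I^j 1`, the `⌈β⌉` derivatives of `I^{⌈β⌉-β+j} 1` lower the order to `j - β`,
which stays nonnegative. The interval up to `t + 1` only makes `t` an interior point. -/
theorem phiFrac_eq {j : ℕ} {β t : ℝ} (hβ : β ≤ j) (ht : 0 < t) :
    PhiFrac j β t = rlIntegral (j - β) (fun _ => 1) t := by
  have hceil := Nat.le_ceil β
  have hone : ContinuousOn (fun _ : ℝ => (1 : ℝ)) (Icc 0 (t + 1)) := continuousOn_const
  have h0 : EqOn (rlIntegral ((⌈β⌉₊ : ℝ) - β) (Phi j))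
      (rlIntegral (j - β + (⌈β⌉₊ - (0 : ℕ))) (fun _ => 1)) (Ioo 0 (t + 1)) := by
    intro s hs
    have hs' := Ioo_subset_Icc_self hs
    rw [rlIntegral_congr (fun x hx => (rlIntegral_const_one_nat j hx.1).symm) hs',
      rlIntegral_rlIntegral (sub_nonneg.2 hceil) j.cast_nonneg hone hs']
    push_cast
    ring_nf
  have h := iteratedDeriv_eqOn_of_chain isOpen_Ioo (n := ⌈β⌉₊)
    (u := fun k => rlIntegral (j - β + (⌈β⌉₊ - k)) (fun _ => 1)) h0 (fun k hk s hs => by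
      have hk' : (k : ℝ) + 1 ≤ ⌈β⌉₊ := by exact_mod_cast hk
      have := hasDerivWithinAt_rlIntegral (γ := j - β + (⌈β⌉₊ - (k + 1 : ℕ)))
        (by push_cast; linarith) hone (Ioo_subset_Icc_self hs)
      rw [show (j : ℝ) - β + (⌈β⌉₊ - (k + 1 : ℕ)) + 1 = j - β + (⌈β⌉₊ - k) by
        push_cast; ring] at this
      exact this.hasDerivAt (Icc_mem_nhds hs.1 hs.2)) _ le_rfl (show t ∈ Ioo 0 (t + 1) by
        constructor <;> linarith)
  simpa [PhiFrac, rlDeriv] using h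

/-- For `c = δ_j` the inner sum of `taylorSource` is nonzero only if `⌈α_i⌉ ≤ j`, that is `α_i ≤ j`;
the hypothesis on `p` says that these indices form the final segment `i ≥ p`. -/
theorem sourceTerm_eq_taylorSource {p j : ℕ} (hp : 1 ≤ p)
    (hpj : ∀ i ∈ Finset.Icc 1 m, p ≤ i ↔ α i ≤ j) (hj : j < ⌈α 0⌉₊) {t : ℝ} (ht : 0 < t) :
    sourceTerm m α a p j t = taylorSource m α a (fun k => if j = k then 1 else 0) t := by
  have hset : Finset.Icc p m = (Finset.Icc 1 m).filter (fun i => α i ≤ j) := by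
    ext i
    simp only [Finset.mem_filter]
    constructor
    · intro hi
      have hi' := Finset.mem_Icc.1 hi
      have h1 : i ∈ Finset.Icc 1 m := Finset.mem_Icc.2 ⟨hp.trans hi'.1, hi'.2⟩
      exact ⟨h1, (hpj i h1).1 hi'.1⟩
    · rintro ⟨h1, h2⟩
      exact Finset.mem_Icc.2 ⟨(hpj i h1).2 h2, (Finset.mem_Icc.1 h1).2⟩
  rw [sourceTerm, hset, Finset.sum_filter, taylorSource]
  refine Finset.sum_congr rfl fun i _ => ?_
  simp only [ite_mul, one_mul, zero_mul, Finset.sum_ite_eq, Finset.mem_Ico, hj, and_true,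
    Nat.ceil_le]
  split_ifs with h
  · rw [phiFrac_eq h ht]
  · rw [mul_zero]

/-- As `α` decreases, `H_j` is a final segment of `{1, …, m}`, hence determined by its minimum. -/
theorem idxh_le_iff {j : ℕ} (hα_nonneg : ∀ i ≤ m, 0 ≤ α i)
    (hα_anti : ∀ i j, i < j → j ≤ m → α j < α i) (hH : (idxH m α j).Nonempty) :
    1 ≤ idxh m α j ∧ ∀ i ∈ Finset.Icc 1 m, idxh m α j ≤ i ↔ α i ≤ j := by
  have hmem : idxh m α j ∈ idxH m α j := Nat.sInf_mem hH
  refine ⟨hmem.1, fun i hi => ?_⟩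
  have hi' := Finset.mem_Icc.1 hi
  constructor
  · intro h
    rcases h.eq_or_lt with h | h
    · rw [← h]; exact hmem.2.2.2
    · exact (hα_anti _ _ h hi'.2).le.trans hmem.2.2.2
  · intro h
    exact Nat.sInf_le ⟨hi'.1, hi'.2, hα_nonneg i hi'.2, h⟩

end Equation

end FracODE

theorem corollary2 (T : ℝ) (hT : 0 < T) (m : ℕ) (α : ℕ → ℝ) (a : ℕ → ℝ → ℝ)
    (hα_nonneg : ∀ i ≤ m, 0 ≤ α i)
    (hα_anti : ∀ i j, i < j → j ≤ m → α j < α i)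
    (hn : ⌈α 1⌉₊ < ⌈α 0⌉₊)
    (ha : ∀ i, 1 ≤ i → i ≤ m → ContinuousOn (a i) (Set.Icc 0 T))
    (hH : (FracODE.idxH m α 0).Nonempty) :
    ∃ y : ℕ → ℝ → ℝ,
      FracODE.IsCanonicalSystem T m α a y ∧
      (∀ j < ⌈α 1⌉₊, ∀ t ∈ Set.Icc 0 T,
        HasSum (fun k => FracODE.seriesTerm m α a (FracODE.idxh m α j) j k t)
          (y j t - FracODE.Phi j t)) ∧
      (∀ j, ⌈α 1⌉₊ ≤ j → j < ⌈α 0⌉₊ → ∀ t ∈ Set.Icc 0 T,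
        HasSum (fun k => FracODE.seriesTerm m α a 1 j k t) (y j t - FracODE.Phi j t)) ∧
      ∀ b : ℕ → ℝ,
        FracODE.IsIVPSolution T m α a b
          (fun t => ∑ j ∈ Finset.range ⌈α 0⌉₊, b j * y j t) ∧
        ∀ z : ℝ → ℝ, FracODE.IsIVPSolution T m α a b z →
          Set.EqOn z (fun t => ∑ j ∈ Finset.range ⌈α 0⌉₊, b j * y j t) (Set.Icc 0 T) := by
  have hα0 : 0 < α 0 := Nat.ceil_pos.1 (Nat.zero_lt_of_lt hn)
  have hα : ∀ i ∈ Finset.Icc 1 m, α i < α 0 := fun i hi =>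
    hα_anti 0 i (Finset.mem_Icc.1 hi).1 (Finset.mem_Icc.1 hi).2
  have ha' : ∀ i ∈ Finset.Icc 1 m, ContinuousOn (a i) (Set.Icc 0 T) := fun i hi =>
    ha i (Finset.mem_Icc.1 hi).1 (Finset.mem_Icc.1 hi).2
  -- `g j` is the density `ᶜD^{α₀} y_j`, obtained as the Neumann series with the source of
  -- `Φ_{j+1}`.
  choose g hgc hgeq hgsum using fun j : ℕ => FracODE.exists_neumann_series hα ha'
    (FracODE.continuousOn_taylorSource (α := α) ha' fun k => if j = k then 1 else 0)
  set y : ℕ → ℝ → ℝ := fun j t => FracODE.Phi j t + FracODE.rlIntegral (α 0) (g j) t with hy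
  have hseries : ∀ p j : ℕ, 1 ≤ p → (∀ i ∈ Finset.Icc 1 m, p ≤ i ↔ α i ≤ j) → j < ⌈α 0⌉₊ →
      ∀ t ∈ Set.Icc 0 T, HasSum (fun k => FracODE.seriesTerm m α a p j k t)
        (y j t - FracODE.Phi j t) := by
    intro p j hp hpj hj t ht
    have h := hgsum j (α 0) hα0.le t ht
    have hsrc : Set.EqOn (FracODE.sourceTerm m α a p j)
        (FracODE.taylorSource m α a fun k => if j = k then 1 else 0) (Set.Ioc 0 T) :=
      fun s hs => FracODE.sourceTerm_eq_taylorSource hp hpj hj hs.1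
    simp only [hy, add_sub_cancel_left, FracODE.seriesTerm]
    refine h.congr_fun fun k => ?_
    rw [FracODE.rlIntegral_congr_of_ne hα0.ne' ht.1 fun s hs =>
      FracODE.opL_iterate_congr hα hsrc k ⟨hs.1, hs.2.le.trans ht.2⟩]
  -- By linearity of the source and of `L`, the density `∑ b_j g_j` solves the Volterra equation
  -- with source `S_b`.
  have hcomb : ∀ b : ℕ → ℝ, ∃ G : ℝ → ℝ, ContinuousOn G (Set.Icc 0 T) ∧
      Set.EqOn (fun t => ∑ j ∈ Finset.range ⌈α 0⌉₊, b j * y j t)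
        (FracODE.fracTaylor (α 0) b G 0 0) (Set.Icc 0 T) ∧
      ∀ t ∈ Set.Icc 0 T, G t = -FracODE.taylorSource m α a b t - FracODE.opL m α a G t := by
    intro b
    have hbg : ∀ j ∈ Finset.range ⌈α 0⌉₊, ContinuousOn (fun s => b j * g j s) (Set.Icc 0 T) :=
      fun j _ => continuousOn_const.mul (hgc j)
    refine ⟨fun t => ∑ j ∈ Finset.range ⌈α 0⌉₊, b j * g j t, continuousOn_finsetSum _ hbg,
      fun t ht => ?_, fun t ht => ?_⟩
    · rw [FracODE.fracTaylor_zero_zero ht.1, FracODE.rlIntegral_sum hα0.le _ hbg ht,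
        ← Finset.sum_add_distrib]
      exact Finset.sum_congr rfl fun j _ => by rw [FracODE.rlIntegral_const_mul, hy]; ring
    · rw [FracODE.opL_sum hα _ hbg ht, FracODE.taylorSource_eq_sum b t, ← Finset.sum_neg_distrib,
        ← Finset.sum_sub_distrib]
      refine Finset.sum_congr rfl fun j _ => ?_
      rw [FracODE.opL_const_mul, hgeq j t ht]
      ring
  have hsol : ∀ b : ℕ → ℝ, FracODE.IsIVPSolution T m α a b
      (fun t => ∑ j ∈ Finset.range ⌈α 0⌉₊, b j * y j t) := by
    intro b
    obtain ⟨G, hG, hrep, heq⟩ := hcomb b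
    exact FracODE.isIVPSolution_of_eqOn_fracTaylor hT hα0 hα hG hrep
      fun t ht => heq t (Set.Ioo_subset_Icc_self ht)
  refine ⟨y, fun j hj => ?_, fun j hj => ?_, fun j hj hj0 => ?_, fun b => ⟨hsol b, fun z hz => ?_⟩⟩
  · have h := hsol fun k => if j = k then 1 else 0
    simpa [ite_mul, Finset.sum_ite_eq, hj] using h
  · obtain ⟨i, hi1, hi2, hi3, hi4⟩ := hH
    -- `H_0 ⊆ H_j`, so `h_j` is a genuine minimum and not the default value of `sInf` on the empty
    -- set.
    have hne : (FracODE.idxH m α j).Nonempty :=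
      ⟨i, hi1, hi2, hi3, hi4.trans (by exact_mod_cast Nat.zero_le j)⟩
    obtain ⟨h1, h2⟩ := FracODE.idxh_le_iff hα_nonneg hα_anti hne
    exact hseries _ j h1 h2 (hj.trans hn)
  · refine hseries 1 j le_rfl (fun i hi => ?_) hj0
    have hi' := Finset.mem_Icc.1 hi
    have h1 : α i ≤ α 1 := by
      rcases hi'.1.eq_or_lt with h | h
      · rw [h]
      · exact (hα_anti 1 i h hi'.2).le
    exact iff_of_true hi'.1 (h1.trans (Nat.ceil_le.1 hj))
  · obtain ⟨G, hG, hrep, heq⟩ := hcomb b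
    obtain ⟨G', hG', hrep', heq'⟩ := FracODE.exists_eqOn_fracTaylor_of_isIVPSolution hT hα0 hα hz
    -- Both densities solve the Volterra equation with the same source, so their difference solves
    -- the homogeneous one.
    have hzero := FracODE.eq_zero_of_eq_neg_opL hT hα ha' (hG'.sub hG) fun t ht => by
      have ht' := Set.Ioo_subset_Icc_self ht
      have := FracODE.opL_sub (a := a) hα hG' hG ht'
      change G' t - G t = -FracODE.opL m α a (fun s => G' s - G s) t
      rw [this, heq' t ht, heq t ht']
      ring
    have hGG : Set.EqOn G' G (Set.Icc 0 T) := fun t ht => sub_eq_zero.1 (hzero ht)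
    intro t ht
    rw [hrep ht, hrep' ht, FracODE.fracTaylor_zero_zero ht.1, FracODE.fracTaylor_zero_zero ht.1,
      FracODE.rlIntegral_congr hGG ht]
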